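/- Model of computation: a real RAM, i.e. a random access machine whose memory consists of finitely many arrays of natural numbers (used for indices and counters) and finitely many arrays of real numbers, initially zero except for the input. Programs are built from assignments to array cells, sequencing, conditionals and while-loops. Memory accesses (an index may itself be read from memory or computed), integer constants, addition and (truncated) subtraction of natural numbers, $+,-,\times,\div$ on reals, comparisons of naturals or of reals, and logical connectives cost one step each; each assignment or empty statement costs one further step. There is no floor function and no other conversion from reals to integers. 2D convex hull problem: given $n$ and points $p_1,\dots,p_n\in\mathbb R^2$, report, each exactly once and sorted by $x$-coordinate (ties broken by $y$-coordinate), the points of $S=\{p_1,\dots,p_n\}$ that lie on the boundary of the convex hull of $S$. Theorem (Bentley–Shamos). There is a (deterministic) algorithm, i.e. a single program for this machine, that halts with the correct output of the 2D convex hull problem for every $n\ge 0$ and all $p_1,\dots,p_n\in\mathbb R^2$, and whose running time $T_n(p_1,\dots,p_n)$ (number of steps) satisfies: $T_n$ is a measurable function of the input, and there is a constant $C$ such that for every $n\ge 1$, if $p_1,\dots,p_n$ are drawn independently and uniformly from the unit square $[0,1]\times[0,1]$, then $$\mathbb E\,[T_n(p_1,\dots,p_n)]\le C\,n .$$ -/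

import Mathlib

open MeasureTheory Set
open scoped ENNReal NNReal

namespace RealRAM

/-- Memory of the machine: finitely many named arrays (a program mentions only finitely many
names) of natural numbers, used for indices and counters, and of real numbers.
A scalar variable is cell `0` of an array. -/
structure Store where
  int : ℕ → ℕ → ℕ
  real : ℕ → ℕ → ℝ

/-- Index expressions; `get a i` reads cell `i` of the integer array `a`.
Subtraction is truncated at `0`. -/
inductive IExp where
  | lit (k : ℕ)
  | get (a : ℕ) (i : IExp)
  | add (e f : IExp)
  | sub (e f : IExp)

/-- Real expressions; `get a i` reads cell `i` of the real array `a`. The only constants are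
integers, and there is neither a floor function nor any other conversion from reals
to integers. -/
inductive RExp where
  | lit (k : ℤ)
  | get (a : ℕ) (i : IExp)
  | add (e f : RExp)
  | sub (e f : RExp)
  | mul (e f : RExp)
  | div (e f : RExp)

/-- Tests: comparisons of integers, comparisons of reals, and Boolean combinations. -/
inductive BExp where
  | ilt (e f : IExp)
  | rlt (e f : RExp)
  | neg (b : BExp)
  | and (b c : BExp)

/-- Programs. -/
inductive Cmd where
  | skip
  | iset (a : ℕ) (i e : IExp)
  | rset (a : ℕ) (i : IExp) (e : RExp)
  | seq (c d : Cmd)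
  | ite (b : BExp) (c d : Cmd)
  | loop (b : BExp) (c : Cmd)

def IExp.eval (s : Store) : IExp → ℕ
  | .lit k => k
  | .get a i => s.int a (i.eval s)
  | .add e f => e.eval s + f.eval s
  | .sub e f => e.eval s - f.eval s

/-- Division by zero returns `0`. -/
noncomputable def RExp.eval (s : Store) : RExp → ℝ
  | .lit k => (k : ℝ)
  | .get a i => s.real a (i.eval s)
  | .add e f => e.eval s + f.eval s
  | .sub e f => e.eval s - f.eval s
  | .mul e f => e.eval s * f.eval s
  | .div e f => e.eval s / f.eval s

def BExp.Holds (s : Store) : BExp → Prop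
  | .ilt e f => e.eval s < f.eval s
  | .rlt e f => e.eval s < f.eval s
  | .neg b => ¬ b.Holds s
  | .and b c => b.Holds s ∧ c.Holds s

/-- Unit cost: every constant, memory access, arithmetic operation, comparison and logical
connective takes one step. -/
def IExp.cost : IExp → ℕ
  | .lit _ => 1
  | .get _ i => i.cost + 1
  | .add e f => e.cost + f.cost + 1
  | .sub e f => e.cost + f.cost + 1

def RExp.cost : RExp → ℕ
  | .lit _ => 1
  | .get _ i => i.cost + 1
  | .add e f => e.cost + f.cost + 1
  | .sub e f => e.cost + f.cost + 1
  | .mul e f => e.cost + f.cost + 1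
  | .div e f => e.cost + f.cost + 1

def BExp.cost : BExp → ℕ
  | .ilt e f => e.cost + f.cost + 1
  | .rlt e f => e.cost + f.cost + 1
  | .neg b => b.cost + 1
  | .and b c => b.cost + c.cost + 1

/-- Overwrite cell `i` of the integer array `a` by `v`. -/
def Store.setInt (s : Store) (a i v : ℕ) : Store :=
  { s with int := Function.update s.int a (Function.update (s.int a) i v) }

/-- Overwrite cell `i` of the real array `a` by `v`. -/
noncomputable def Store.setReal (s : Store) (a i : ℕ) (v : ℝ) : Store :=
  { s with real := Function.update s.real a (Function.update (s.real a) i v) }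

/-- `Exec c s t s'`: started in the store `s`, the program `c` halts after exactly `t` steps,
in the store `s'`. -/
inductive Exec : Cmd → Store → ℕ → Store → Prop
  | skip (s : Store) : Exec .skip s 1 s
  | iset (a : ℕ) (i e : IExp) (s : Store) :
      Exec (.iset a i e) s (i.cost + e.cost + 1) (s.setInt a (i.eval s) (e.eval s))
  | rset (a : ℕ) (i : IExp) (e : RExp) (s : Store) :
      Exec (.rset a i e) s (i.cost + e.cost + 1) (s.setReal a (i.eval s) (e.eval s))
  | seq {c d : Cmd} {s s' s'' : Store} {t u : ℕ} :
      Exec c s t s' → Exec d s' u s'' → Exec (.seq c d) s (t + u) s''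
  | ite_true {b : BExp} {c d : Cmd} {s s' : Store} {t : ℕ} :
      b.Holds s → Exec c s t s' → Exec (.ite b c d) s (b.cost + t) s'
  | ite_false {b : BExp} {c d : Cmd} {s s' : Store} {t : ℕ} :
      ¬ b.Holds s → Exec d s t s' → Exec (.ite b c d) s (b.cost + t) s'
  | loop_done {b : BExp} {c : Cmd} {s : Store} :
      ¬ b.Holds s → Exec (.loop b c) s b.cost s
  | loop_next {b : BExp} {c : Cmd} {s s' s'' : Store} {t u : ℕ} :
      b.Holds s → Exec c s t s' → Exec (.loop b c) s' u s'' →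
        Exec (.loop b c) s (b.cost + t + u) s''

/-- The machine is deterministic. -/
theorem Exec.det {c : Cmd} {s s₁ s₂ : Store} {t₁ t₂ : ℕ}
    (h₁ : Exec c s t₁ s₁) (h₂ : Exec c s t₂ s₂) : t₁ = t₂ ∧ s₁ = s₂ := by
  induction h₁ generalizing t₂ s₂ with
  | skip s => cases h₂; exact ⟨rfl, rfl⟩
  | iset a i e s => cases h₂; exact ⟨rfl, rfl⟩
  | rset a i e s => cases h₂; exact ⟨rfl, rfl⟩
  | seq _ _ ih₁ ih₂ =>
    cases h₂ with
    | seq k₁ k₂ =>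
      obtain ⟨rfl, rfl⟩ := ih₁ k₁
      obtain ⟨rfl, rfl⟩ := ih₂ k₂
      exact ⟨rfl, rfl⟩
  | ite_true hb _ ih =>
    cases h₂ with
    | ite_true _ k => obtain ⟨rfl, rfl⟩ := ih k; exact ⟨rfl, rfl⟩
    | ite_false hn _ => exact absurd hb hn
  | ite_false hb _ ih =>
    cases h₂ with
    | ite_true hn _ => exact absurd hn hb
    | ite_false _ k => obtain ⟨rfl, rfl⟩ := ih k; exact ⟨rfl, rfl⟩
  | loop_done hb =>
    cases h₂ with
    | loop_done _ => exact ⟨rfl, rfl⟩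
    | loop_next hn _ _ => exact absurd hn hb
  | loop_next hb _ _ ih₁ ih₂ =>
    cases h₂ with
    | loop_done hn => exact absurd hb hn
    | loop_next _ k₁ k₂ =>
      obtain ⟨rfl, rfl⟩ := ih₁ k₁
      obtain ⟨rfl, rfl⟩ := ih₂ k₂
      exact ⟨rfl, rfl⟩

/-- The running time (number of steps) of the program `c` from the store `s`;
it is `∞` if `c` does not halt. -/
noncomputable def runTime (c : Cmd) (s : Store) : ℝ≥0∞ :=
  ⨅ (t : ℕ) (_ : ∃ s', Exec c s t s'), (t : ℝ≥0∞)

end RealRAM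

open RealRAM

/-- The input store for the points `p 0, …, p (n - 1)`: the number `n` is in cell `0` of the
integer array `0`, the abscissas are in the real array `0`, the ordinates in the real
array `1`. All other cells are `0`. -/
noncomputable def hullInput {n : ℕ} (p : Fin n → ℝ × ℝ) : Store where
  int a i := if a = 0 ∧ i = 0 then n else 0
  real a i :=
    if h : i < n then
      if a = 0 then (p ⟨i, h⟩).1 else if a = 1 then (p ⟨i, h⟩).2 else 0
    else 0

/-- The `i`-th point of the output: real arrays `2` (abscissas) and `3` (ordinates). -/
def outPoint (s : Store) (i : ℕ) : ℝ × ℝ := (s.real 2 i, s.real 3 i)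

/-- The number of points in the output: cell `0` of the integer array `1`. -/
def outLength (s : Store) : ℕ := s.int 1 0

/-- The output lists exactly the points of `S` that lie on (the boundary of) the convex hull
of `S`, each of them once, sorted by abscissa (ties by ordinate). -/
def IsHullOutput (S : Set (ℝ × ℝ)) (s : Store) : Prop :=
  {q | ∃ i < outLength s, outPoint s i = q} = S ∩ frontier (convexHull ℝ S) ∧
  ∀ i j, i < j → j < outLength s →
    (outPoint s i).1 < (outPoint s j).1 ∨
      ((outPoint s i).1 = (outPoint s j).1 ∧ (outPoint s i).2 < (outPoint s j).2)

/-- The program `c` solves the 2D convex hull problem on every input: it halts with a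
correct output. -/
def SolvesConvexHull (c : Cmd) : Prop :=
  ∀ (n : ℕ) (p : Fin n → ℝ × ℝ), ∃ (t : ℕ) (s : Store),
    Exec c (hullInput p) t s ∧ IsHullOutput (Set.range p) s

/-- The joint law of `n` independent uniformly distributed points of the unit square. -/
noncomputable def uniformPoints (n : ℕ) : Measure (Fin n → ℝ × ℝ) :=
  Measure.pi fun _ => (volume : Measure (ℝ × ℝ)).restrict (Icc 0 1 ×ˢ Icc 0 1)

namespace RealRAM

/-! ### Measurability of the running time -/

/-! The algorithm throws most points away in linear time and treats the rest by brute force. For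
each corner of the unit square it computes the smallest sup-distance from that corner to an input
point (`cornerDist`). A point whose two coordinates, measured from each corner, both exceed the
distance of that corner is discarded: the input point nearest to a corner lies in the open quadrant
towards it, so a discarded point has input points in all four open quadrants (`IsInner.surrounded`).
Such a point is never on the boundary, and no linear functional attains its maximum there, so the
kept points determine the same supporting lines (`supports_of_subset`). This uses only the order of
coordinates, so correctness does not require points in the square.

Among `m` kept points, lying on the boundary means lying on a supporting line
(`mem_frontier_convexHull_iff`), which two greatest-slope sweeps decide in `O(m)` steps
(`MaxSlope.upperSupport_iff`). Selecting boundary points, removing duplicates and sorting by rank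
therefore cost `O(m ^ 2)`, and the total is `O(n + (m + 1) ^ 2)` (`exists_runs_hullProgram`).

It remains to see that `m ^ 2` has expectation `O(n)`. A kept point has, up to one of the eight
symmetries of the square, an abscissa at most the sup-norm of every input point (`nearAxis`). Two
given points with abscissas `s`, `t` both do so with probability at most the integral of `(1 -
max(s,t)^2)^(n-2)`, which is `1 / (n - 1)` (`lintegral_max_le`). Summing over pairs bounds the
second moment for one symmetry by `2 * n`, and Cauchy–Schwarz over the symmetries gives `128 * n`.

The running time is measurable because a program has countably many computation paths, each with a
measurable domain and a fixed length.

Array usage. Integers: `0` input size, `1` output length, `2` kept count, `3` and `4` outer and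
inner counters, `5`–`7` flags, `8` rank. Reals: `0`, `1` input; `2`, `3` output; `4`, `5` kept
points; `6`, `7` boundary points; `8`, `9` steepest vector; `10`–`13` corner distances. -/

instance : MeasurableSpace Store :=
  MeasurableSpace.comap (fun s => (s.int, s.real)) inferInstance

theorem measurable_store_iff {α : Type*} [MeasurableSpace α] {f : α → Store} :
    Measurable f ↔ (∀ a i, Measurable fun x => (f x).int a i) ∧
      ∀ a i, Measurable fun x => (f x).real a i := by
  rw [measurable_comap_iff]
  constructor
  · intro h
    exact ⟨fun a i => (measurable_pi_apply i).comp ((measurable_pi_apply a).comp h.fst),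
      fun a i => (measurable_pi_apply i).comp ((measurable_pi_apply a).comp h.snd)⟩
  · rintro ⟨h₁, h₂⟩
    exact Measurable.prodMk
      (measurable_pi_iff.2 fun a => measurable_pi_iff.2 fun i => h₁ a i)
      (measurable_pi_iff.2 fun a => measurable_pi_iff.2 fun i => h₂ a i)

theorem measurable_int (a i : ℕ) : Measurable fun s : Store => s.int a i :=
  (measurable_store_iff.1 measurable_id).1 a i

theorem measurable_real (a i : ℕ) : Measurable fun s : Store => s.real a i :=
  (measurable_store_iff.1 measurable_id).2 a i

theorem IExp.measurable_eval (e : IExp) : Measurable fun s => e.eval s := by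
  induction e with
  | lit k => exact measurable_const
  | get a i ih =>
    -- The address is computed from the store, but it ranges over a countable set, so it suffices to
    -- treat each fixed address.
    exact (measurable_from_prod_countable_right (f := fun q : ℕ × Store => q.2.int a q.1)
      fun k => measurable_int a k).comp (ih.prodMk measurable_id)
  | add e f ihe ihf => exact ihe.add ihf
  | sub e f ihe ihf => exact ihe.sub ihf

theorem RExp.measurable_eval (e : RExp) : Measurable fun s => e.eval s := by
  induction e with
  | lit k => exact measurable_const
  | get a i =>
    exact (measurable_from_prod_countable_right (f := fun q : ℕ × Store => q.2.real a q.1)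
      fun k => measurable_real a k).comp (i.measurable_eval.prodMk measurable_id)
  | add e f ihe ihf => exact ihe.add ihf
  | sub e f ihe ihf => exact ihe.sub ihf
  | mul e f ihe ihf => exact ihe.mul ihf
  | div e f ihe ihf => exact ihe.div ihf

theorem BExp.measurableSet_holds (b : BExp) : MeasurableSet {s | b.Holds s} := by
  induction b with
  | ilt e f => exact measurableSet_lt e.measurable_eval f.measurable_eval
  | rlt e f => exact measurableSet_lt e.measurable_eval f.measurable_eval
  | neg b ih => exact ih.compl
  | and b c ihb ihc => exact ihb.inter ihc

theorem setInt_int (s : Store) (a i v b j : ℕ) :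
    (s.setInt a i v).int b j = if b = a ∧ j = i then v else s.int b j := by
  by_cases h : b = a
  · subst h
    by_cases h' : j = i <;> simp [Store.setInt, h']
  · simp [Store.setInt, h]

theorem setReal_real (s : Store) (a i : ℕ) (v : ℝ) (b j : ℕ) :
    (s.setReal a i v).real b j = if b = a ∧ j = i then v else s.real b j := by
  by_cases h : b = a
  · subst h
    by_cases h' : j = i <;> simp [Store.setReal, h']
  · simp [Store.setReal, h]

theorem measurable_setInt (a : ℕ) (i e : IExp) :
    Measurable fun s : Store => s.setInt a (i.eval s) (e.eval s) := by
  refine measurable_store_iff.2 ⟨fun b j => ?_, fun b j => measurable_real b j⟩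
  simp only [setInt_int]
  refine Measurable.ite ?_ e.measurable_eval (measurable_int b j)
  exact (MeasurableSet.const (b = a)).inter
    (measurableSet_eq_fun measurable_const i.measurable_eval)

theorem measurable_setReal (a : ℕ) (i : IExp) (e : RExp) :
    Measurable fun s : Store => s.setReal a (i.eval s) (e.eval s) := by
  refine measurable_store_iff.2 ⟨fun b j => measurable_int b j, fun b j => ?_⟩
  simp only [setReal_real]
  refine Measurable.ite ?_ e.measurable_eval (measurable_real b j)
  exact (MeasurableSet.const (b = a)).inter
    (measurableSet_eq_fun measurable_const i.measurable_eval)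

/-- A computation path: the set of stores from which it is followed, its length, and the
transformation of the store along it. -/
structure Path where
  dom : Set Store
  time : ℕ
  map : Store → Store

/-- A path that starts with the test `b`, if its outcome is in `B`. -/
def Path.guard (B : Set Store) (b : BExp) (π : Path) : Path :=
  ⟨B ∩ π.dom, b.cost + π.time, π.map⟩

/-- Concatenation of paths. -/
def Path.comp (π ρ : Path) : Path :=
  ⟨π.dom ∩ π.map ⁻¹' ρ.dom, π.time + ρ.time, ρ.map ∘ π.map⟩

def Path.Meas (π : Path) : Prop := MeasurableSet π.dom ∧ Measurable π.map

theorem Path.Meas.guard {π : Path} (h : π.Meas) {B : Set Store} (hB : MeasurableSet B)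
    (b : BExp) : (π.guard B b).Meas :=
  ⟨hB.inter h.1, h.2⟩

theorem Path.Meas.comp {π ρ : Path} (h : π.Meas) (k : ρ.Meas) : (π.comp ρ).Meas :=
  ⟨h.1.inter (h.2 k.1), k.2.comp h.2⟩

/-- The paths through a loop with exactly `k` iterations. -/
def loopPaths (b : BExp) (P : Set Path) : ℕ → Set Path
  | 0 => {⟨{s | ¬ b.Holds s}, b.cost, id⟩}
  | k + 1 => image2 (fun π ρ => (π.guard {s | b.Holds s} b).comp ρ) P (loopPaths b P k)

/-- The computation paths of a program. -/
def Cmd.paths : Cmd → Set Path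
  | .skip => {⟨univ, 1, id⟩}
  | .iset a i e => {⟨univ, i.cost + e.cost + 1, fun s => s.setInt a (i.eval s) (e.eval s)⟩}
  | .rset a i e => {⟨univ, i.cost + e.cost + 1, fun s => s.setReal a (i.eval s) (e.eval s)⟩}
  | .seq c d => image2 Path.comp c.paths d.paths
  | .ite b c d => (Path.guard {s | b.Holds s} b '' c.paths) ∪
      (Path.guard {s | ¬ b.Holds s} b '' d.paths)
  | .loop b c => ⋃ k, loopPaths b c.paths k

theorem Cmd.countable_paths (c : Cmd) : c.paths.Countable := by
  induction c with
  | skip => exact countable_singleton _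
  | iset a i e => exact countable_singleton _
  | rset a i e => exact countable_singleton _
  | seq c d ihc ihd => exact ihc.image2 ihd _
  | ite b c d ihc ihd => exact (ihc.image _).union (ihd.image _)
  | loop b c ih =>
    refine countable_iUnion fun k => ?_
    induction k with
    | zero => exact countable_singleton _
    | succ k ihk => exact ih.image2 ihk _

theorem Cmd.meas_of_mem_paths (c : Cmd) : ∀ π ∈ c.paths, π.Meas := by
  induction c with
  | skip => rintro _ rfl; exact ⟨MeasurableSet.univ, measurable_id⟩
  | iset a i e => rintro _ rfl; exact ⟨MeasurableSet.univ, measurable_setInt a i e⟩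
  | rset a i e => rintro _ rfl; exact ⟨MeasurableSet.univ, measurable_setReal a i e⟩
  | seq c d ihc ihd => rintro _ ⟨π, hπ, ρ, hρ, rfl⟩; exact (ihc π hπ).comp (ihd ρ hρ)
  | ite b c d ihc ihd =>
    rintro _ (⟨π, hπ, rfl⟩ | ⟨π, hπ, rfl⟩)
    · exact (ihc π hπ).guard b.measurableSet_holds b
    · exact (ihd π hπ).guard b.measurableSet_holds.compl b
  | loop b c ih =>
    intro π hπ
    obtain ⟨k, hk⟩ := mem_iUnion.1 hπ
    clear hπ
    induction k generalizing π with
    | zero =>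
      rw [loopPaths, mem_singleton_iff] at hk
      subst hk
      exact ⟨b.measurableSet_holds.compl, measurable_id⟩
    | succ k ihk =>
      obtain ⟨π, hπ, ρ, hρ, rfl⟩ := hk
      exact ((ih π hπ).guard b.measurableSet_holds b).comp (ihk ρ hρ)

theorem Exec.exists_path {c : Cmd} {s s' : Store} {t : ℕ} (h : Exec c s t s') :
    ∃ π ∈ c.paths, s ∈ π.dom ∧ π.time = t ∧ π.map s = s' := by
  induction h with
  | skip s => exact ⟨_, rfl, trivial, rfl, rfl⟩
  | iset a i e s => exact ⟨_, rfl, trivial, rfl, rfl⟩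
  | rset a i e s => exact ⟨_, rfl, trivial, rfl, rfl⟩
  | seq _ _ ih₁ ih₂ =>
    obtain ⟨π, hπ, h₁, rfl, rfl⟩ := ih₁
    obtain ⟨ρ, hρ, h₂, rfl, rfl⟩ := ih₂
    exact ⟨π.comp ρ, ⟨π, hπ, ρ, hρ, rfl⟩, ⟨h₁, h₂⟩, rfl, rfl⟩
  | ite_true hb _ ih =>
    obtain ⟨π, hπ, h₁, rfl, rfl⟩ := ih
    exact ⟨_, Or.inl ⟨π, hπ, rfl⟩, ⟨hb, h₁⟩, rfl, rfl⟩
  | ite_false hb _ ih =>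
    obtain ⟨π, hπ, h₁, rfl, rfl⟩ := ih
    exact ⟨_, Or.inr ⟨π, hπ, rfl⟩, ⟨hb, h₁⟩, rfl, rfl⟩
  | loop_done hb => exact ⟨_, mem_iUnion.2 ⟨0, rfl⟩, hb, rfl, rfl⟩
  | loop_next hb _ _ ih₁ ih₂ =>
    obtain ⟨π, hπ, h₁, rfl, rfl⟩ := ih₁
    obtain ⟨ρ, hρ, h₂, rfl, rfl⟩ := ih₂
    obtain ⟨k, hk⟩ := mem_iUnion.1 hρ
    exact ⟨_, mem_iUnion.2 ⟨k + 1, π, hπ, ρ, hk, rfl⟩, ⟨⟨hb, h₁⟩, h₂⟩, rfl, rfl⟩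

theorem Cmd.exec_of_mem_paths (c : Cmd) :
    ∀ π ∈ c.paths, ∀ s ∈ π.dom, Exec c s π.time (π.map s) := by
  induction c with
  | skip => rintro _ rfl s -; exact .skip s
  | iset a i e => rintro _ rfl s -; exact .iset a i e s
  | rset a i e => rintro _ rfl s -; exact .rset a i e s
  | seq c d ihc ihd =>
    rintro _ ⟨π, hπ, ρ, hρ, rfl⟩ s ⟨h₁, h₂⟩
    exact .seq (ihc π hπ s h₁) (ihd ρ hρ _ h₂)
  | ite b c d ihc ihd =>
    rintro _ (⟨π, hπ, rfl⟩ | ⟨π, hπ, rfl⟩) s ⟨hb, hs⟩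
    · exact .ite_true hb (ihc π hπ s hs)
    · exact .ite_false hb (ihd π hπ s hs)
  | loop b c ih =>
    intro π hπ s hs
    obtain ⟨k, hk⟩ := mem_iUnion.1 hπ
    clear hπ
    induction k generalizing π s with
    | zero =>
      rw [loopPaths, mem_singleton_iff] at hk
      subst hk
      exact .loop_done hs
    | succ k ihk =>
      obtain ⟨π, hπ, ρ, hρ, rfl⟩ := hk
      exact .loop_next hs.1.1 (ih π hπ s hs.1.2) (ihk ρ _ hs.2 hρ)

/-- Paths describe exactly the halting computations, so this set is the union of the domains of the
countably many paths of length `t`. -/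
theorem measurableSet_halts (c : Cmd) (t : ℕ) : MeasurableSet {s | ∃ s', Exec c s t s'} := by
  have : {s | ∃ s', Exec c s t s'} = ⋃ π ∈ {π ∈ c.paths | π.time = t}, π.dom := by
    ext s
    simp only [mem_ofPred_eq, mem_iUnion, exists_prop]
    constructor
    · rintro ⟨s', h⟩
      obtain ⟨π, hπ, hs, ht, -⟩ := h.exists_path
      exact ⟨π, ⟨hπ, ht⟩, hs⟩
    · rintro ⟨π, ⟨hπ, rfl⟩, hs⟩
      exact ⟨_, c.exec_of_mem_paths π hπ s hs⟩
  rw [this]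
  exact MeasurableSet.biUnion (c.countable_paths.mono (sep_subset _ _))
    fun π hπ => (c.meas_of_mem_paths π hπ.1).1

theorem measurable_runTime (c : Cmd) : Measurable (runTime c) := by
  classical
  refine Measurable.iInf fun t => ?_
  have : (fun s => ⨅ _ : ∃ s', Exec c s t s', (t : ℝ≥0∞)) =
      fun s => if s ∈ {s | ∃ s', Exec c s t s'} then (t : ℝ≥0∞) else ⊤ := by
    ext s
    rw [iInf_eq_if]
    rfl
  rw [this]
  exact Measurable.ite (measurableSet_halts c t) measurable_const measurable_const

theorem measurable_hullInput (n : ℕ) :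
    Measurable fun p : Fin n → ℝ × ℝ => hullInput p := by
  refine measurable_store_iff.2 ⟨fun a i => measurable_const, fun a i => ?_⟩
  unfold hullInput
  dsimp only
  by_cases h : i < n
  · simp only [h, dite_true]
    split_ifs
    · exact (measurable_pi_apply _).fst
    · exact (measurable_pi_apply _).snd
    · exact measurable_const
  · simp only [h, dite_false]
    exact measurable_const

theorem runTime_le {c : Cmd} {s s' : Store} {t : ℕ} (h : Exec c s t s') :
    runTime c s ≤ t :=
  iInf₂_le t ⟨s', h⟩

/-! ### Total correctness with time bounds -/

/-- The integer arrays a program may write to. -/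
def Cmd.intVars : Cmd → List ℕ
  | .skip => []
  | .iset a _ _ => [a]
  | .rset _ _ _ => []
  | .seq c d => c.intVars ++ d.intVars
  | .ite _ c d => c.intVars ++ d.intVars
  | .loop _ c => c.intVars

/-- The real arrays a program may write to. -/
def Cmd.realVars : Cmd → List ℕ
  | .skip => []
  | .iset _ _ _ => []
  | .rset a _ _ => [a]
  | .seq c d => c.realVars ++ d.realVars
  | .ite _ c d => c.realVars ++ d.realVars
  | .loop _ c => c.realVars

/-- The stores `s` and `s'` differ only in arrays that `c` writes to. -/
structure Frame (c : Cmd) (s s' : Store) : Prop where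
  int : ∀ a, a ∉ c.intVars → s'.int a = s.int a
  real : ∀ a, a ∉ c.realVars → s'.real a = s.real a

theorem Frame.refl (c : Cmd) (s : Store) : Frame c s s := ⟨fun _ _ => rfl, fun _ _ => rfl⟩

theorem Frame.trans {c : Cmd} {s s' s'' : Store} (h : Frame c s s') (k : Frame c s' s'') :
    Frame c s s'' :=
  ⟨fun a ha => (k.int a ha).trans (h.int a ha), fun a ha => (k.real a ha).trans (h.real a ha)⟩

theorem Frame.mono {c d : Cmd} {s s' : Store} (h : Frame c s s')
    (hi : c.intVars ⊆ d.intVars) (hr : c.realVars ⊆ d.realVars) : Frame d s s' :=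
  ⟨fun a ha => h.int a fun k => ha (hi k), fun a ha => h.real a fun k => ha (hr k)⟩

/-- The written arrays are read off the syntax, so for concrete programs the preservation of an
array can be settled by `decide`. Postconditions then only have to mention what changes. -/
theorem Exec.frame {c : Cmd} {s s' : Store} {t : ℕ} (h : Exec c s t s') : Frame c s s' := by
  induction h with
  | skip s => exact .refl _ _
  | iset a i e s =>
    refine ⟨fun b hb => ?_, fun _ _ => rfl⟩
    ext j
    have : b ≠ a := by simpa [Cmd.intVars] using hb
    simp [setInt_int, this]
  | rset a i e s =>
    refine ⟨fun _ _ => rfl, fun b hb => ?_⟩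
    ext j
    have : b ≠ a := by simpa [Cmd.realVars] using hb
    simp [setReal_real, this]
  | seq _ _ ih₁ ih₂ =>
    exact (ih₁.mono (by simp [Cmd.intVars]) (by simp [Cmd.realVars])).trans
      (ih₂.mono (by simp [Cmd.intVars]) (by simp [Cmd.realVars]))
  | ite_true _ _ ih => exact ih.mono (by simp [Cmd.intVars]) (by simp [Cmd.realVars])
  | ite_false _ _ ih => exact ih.mono (by simp [Cmd.intVars]) (by simp [Cmd.realVars])
  | loop_done _ => exact .refl _ _
  | loop_next _ _ _ ih₁ ih₂ =>
    exact (ih₁.mono (by simp [Cmd.intVars]) (by simp [Cmd.realVars])).trans ih₂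

/-- Started in `s`, the program `c` halts within `T` steps in a store that satisfies `Q`. -/
def Runs (c : Cmd) (s : Store) (T : ℕ) (Q : Store → Prop) : Prop :=
  ∃ t ≤ T, ∃ s', Exec c s t s' ∧ Q s'

theorem Runs.mono {c : Cmd} {s : Store} {T T' : ℕ} {Q Q' : Store → Prop}
    (h : Runs c s T Q) (hT : T ≤ T') (hQ : ∀ s', Frame c s s' → Q s' → Q' s') :
    Runs c s T' Q' := by
  obtain ⟨t, ht, s', he, hq⟩ := h
  exact ⟨t, ht.trans hT, s', he, hQ s' he.frame hq⟩

theorem Runs.seq {c d : Cmd} {s : Store} {T U : ℕ} {Q : Store → Prop}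
    (h : Runs c s T fun s' => Runs d s' U Q) : Runs (.seq c d) s (T + U) Q := by
  obtain ⟨t, ht, s', he, u, hu, s'', he', hq⟩ := h
  exact ⟨t + u, by omega, s'', .seq he he', hq⟩

theorem Runs.skip {s : Store} {Q : Store → Prop} (h : Q s) : Runs .skip s 1 Q :=
  ⟨1, le_rfl, s, .skip s, h⟩

theorem Runs.iset {a : ℕ} {i e : IExp} {s : Store} {Q : Store → Prop}
    (h : Q (s.setInt a (i.eval s) (e.eval s))) :
    Runs (.iset a i e) s (i.cost + e.cost + 1) Q :=
  ⟨_, le_rfl, _, .iset a i e s, h⟩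

theorem Runs.rset {a : ℕ} {i : IExp} {e : RExp} {s : Store} {Q : Store → Prop}
    (h : Q (s.setReal a (i.eval s) (e.eval s))) :
    Runs (.rset a i e) s (i.cost + e.cost + 1) Q :=
  ⟨_, le_rfl, _, .rset a i e s, h⟩

theorem Runs.ite {b : BExp} {c d : Cmd} {s : Store} {T U : ℕ} {Q : Store → Prop}
    (h : b.Holds s → Runs c s T Q) (k : ¬ b.Holds s → Runs d s U Q) :
    Runs (.ite b c d) s (b.cost + (T + U)) Q := by
  by_cases hb : b.Holds s
  · obtain ⟨t, ht, s', he, hq⟩ := h hb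
    exact ⟨b.cost + t, by omega, s', .ite_true hb he, hq⟩
  · obtain ⟨t, ht, s', he, hq⟩ := k hb
    exact ⟨b.cost + t, by omega, s', .ite_false hb he, hq⟩

/-- The number of iterations is known beforehand, which suffices because every loop of the algorithm
is a counting loop. The frame relates each intermediate store to the initial one, so invariants need
not record untouched arrays. -/
theorem Runs.loop {b : BExp} {c : Cmd} {N B : ℕ} {s : Store} (Inv : ℕ → Store → Prop)
    (h₀ : Inv 0 s)
    (hstep : ∀ k < N, ∀ s', Frame c s s' → Inv k s' → b.Holds s' ∧ Runs c s' B (Inv (k + 1)))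
    (hend : ∀ s', Inv N s' → ¬ b.Holds s') :
    Runs (.loop b c) s (N * (b.cost + B) + b.cost) (Inv N) := by
  -- Induction on the number `k` of iterations still to come.
  suffices H : ∀ k ≤ N, ∀ s', Frame c s s' → Inv (N - k) s' →
      Runs (.loop b c) s' (k * (b.cost + B) + b.cost) (Inv N) from
    H N le_rfl s (.refl _ _) (by simpa using h₀)
  intro k
  induction k with
  | zero =>
    intro _ s' _ hI
    exact ⟨b.cost, by simp, s', .loop_done (hend s' hI), hI⟩
  | succ k ih =>
    intro hk s' hf hI
    obtain ⟨hb, t, ht, s₁, he, hI₁⟩ := hstep (N - (k + 1)) (by omega) s' hf hI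
    rw [show N - (k + 1) + 1 = N - k by omega] at hI₁
    obtain ⟨u, hu, s₂, he₂, hq⟩ := ih (by omega) s₁ (hf.trans he.frame) hI₁
    refine ⟨b.cost + t + u, ?_, s₂, .loop_next hb he he₂, hq⟩
    rw [Nat.succ_mul]
    omega

/-- Cell `0` of an integer array. -/
abbrev IExp.var (a : ℕ) : IExp := .get a (.lit 0)

/-- Execute `c` with the variable `i` running from `0` up to the value of the variable `l`
(excluded). -/
def Cmd.for (i l : ℕ) (c : Cmd) : Cmd :=
  .seq (.iset i (.lit 0) (.lit 0))
    (.loop (.ilt (.var i) (.var l)) (.seq c (.iset i (.lit 0) (.add (.var i) (.lit 1)))))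

/-- Each round pays 5 for the test and 6 for the increment; the 8 is initialisation (3) plus the
final failing test (5). `hInv` is needed since the counter is written outside the body. -/
theorem Runs.for {i l : ℕ} {c : Cmd} {N B : ℕ} {s : Store} (Inv : ℕ → Store → Prop)
    (hil : l ≠ i) (hN : s.int l 0 = N) (hl : l ∉ c.intVars)
    (hi : i ∉ c.intVars) (hInv : ∀ k s v, Inv k s → Inv k (s.setInt i 0 v)) (h₀ : Inv 0 s)
    (hstep : ∀ k < N, ∀ s', Frame (.for i l c) s s' → s'.int i 0 = k → Inv k s' →
      Runs c s' B (Inv (k + 1))) :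
    Runs (.for i l c) s (N * (B + 11) + 8) (Inv N) := by
  have hloop : Runs (.for i l c) s (3 + (N * (5 + (B + 6)) + 5))
      fun s' => s'.int i 0 = N ∧ s'.int l 0 = N ∧ Inv N s' := by
    refine Runs.seq (Runs.iset ?_)
    refine Runs.loop (b := .ilt (.var i) (.var l))
      (Inv := fun k s' => s'.int i 0 = k ∧ s'.int l 0 = N ∧ Inv k s') ?_ ?_ ?_
    · refine ⟨by simp [IExp.eval, setInt_int], by simp [IExp.eval, setInt_int, hil, hN], ?_⟩
      exact hInv _ _ _ h₀
    · rintro k hk s' hf ⟨h₁, h₂, h₃⟩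
      refine ⟨by simpa [BExp.Holds, IExp.eval, h₁, h₂] using hk, ?_⟩
      refine Runs.seq (T := B) (U := 6) ((hstep k hk s' ?_ h₁ h₃).mono le_rfl
        fun s₁ hf₁ hI₁ => ?_)
      · refine ⟨fun a ha => ?_, fun a ha => hf.real a (by simpa [Cmd.for, Cmd.realVars] using ha)⟩
        rw [hf.int a (by simp [Cmd.for, Cmd.intVars] at ha ⊢; tauto)]
        ext j
        have : a ≠ i := by rintro rfl; simp [Cmd.for, Cmd.intVars] at ha
        simp [setInt_int, this]
      · refine Runs.iset ?_
        refine ⟨?_, ?_, ?_⟩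
        · simp [IExp.eval, setInt_int, hf₁.int i hi, h₁]
        · simp [IExp.eval, setInt_int, hil, hf₁.int l hl, h₂]
        · exact hInv _ _ _ hI₁
    · rintro s' ⟨h₁, h₂, -⟩
      simp [BExp.Holds, IExp.eval, h₁, h₂]
  refine hloop.mono ?_ fun s' _ h => h.2.2
  have : 5 + (B + 6) = B + 11 := by ring
  rw [this]
  omega

end RealRAM

/-! ### The boundary of the convex hull of a finite planar set -/

/-- The line through `q` with normal vector `(a, b)` supports `S`. -/
def Supports (a b : ℝ) (S : Set (ℝ × ℝ)) (q : ℝ × ℝ) : Prop :=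
  ∀ s ∈ S, a * (s.1 - q.1) + b * (s.2 - q.2) ≤ 0

theorem exists_coeff_of_linearMap (f : ℝ × ℝ →ₗ[ℝ] ℝ) :
    ∃ a b : ℝ, ∀ s, f s = a * s.1 + b * s.2 := by
  refine ⟨f (1, 0), f (0, 1), fun s => ?_⟩
  have : s = s.1 • ((1 : ℝ), (0 : ℝ)) + s.2 • ((0 : ℝ), (1 : ℝ)) := by ext <;> simp
  conv_lhs => rw [this]
  rw [map_add, map_smul, map_smul]
  simp [mul_comm]

/-- If the hull has interior points, Hahn–Banach separates `q` from the interior, and the inequality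
passes to `S` because the closure of the interior contains the hull. Otherwise `S` spans a proper
affine subspace, and a nonzero functional is constant on it. -/
theorem exists_supports_of_notMem_interior {S : Set (ℝ × ℝ)} {q : ℝ × ℝ} (hq : q ∈ S)
    (h : q ∉ interior (convexHull ℝ S)) : ∃ a b, (a ≠ 0 ∨ b ≠ 0) ∧ Supports a b S q := by
  by_cases hne : (interior (convexHull ℝ S)).Nonempty
  · obtain ⟨f, hf⟩ := geometric_hahn_banach_open_point (convex_convexHull ℝ S).interior
      isOpen_interior h
    obtain ⟨a, b, hab⟩ := exists_coeff_of_linearMap (f : ℝ × ℝ →ₗ[ℝ] ℝ)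
    have hab' : ∀ s, f s = a * s.1 + b * s.2 := hab
    refine ⟨a, b, ?_, ?_⟩
    · by_contra! hz
      obtain ⟨z, hz'⟩ := hne
      have := hf z hz'
      rw [hab', hab', hz.1, hz.2] at this
      simp at this
    · intro s hs
      have hcl : s ∈ closure (interior (convexHull ℝ S)) := by
        rw [(convex_convexHull ℝ S).closure_interior_eq_closure_of_nonempty_interior hne]
        exact subset_closure (subset_convexHull ℝ S hs)
      have : f s ≤ f q := by
        refine closure_minimal (t := {z | f z ≤ f q}) (fun z hz => (hf z hz).le) ?_ hcl
        exact isClosed_le f.continuous continuous_const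
      rw [hab', hab'] at this
      linarith
  · rw [interior_convexHull_nonempty_iff_affineSpan_eq_top] at hne
    have hdir : (affineSpan ℝ S).direction < ⊤ := by
      refine lt_top_iff_ne_top.2 fun hd => hne ?_
      exact (AffineSubspace.direction_eq_top_iff_of_nonempty
        ⟨q, subset_affineSpan ℝ S hq⟩).1 hd
    obtain ⟨f, hf0, hf⟩ := Submodule.exists_le_ker_of_lt_top _ hdir
    obtain ⟨a, b, hab⟩ := exists_coeff_of_linearMap f
    refine ⟨a, b, ?_, fun s hs => ?_⟩
    · by_contra! hz
      exact hf0 (LinearMap.ext fun s => by simp [hab, hz.1, hz.2])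
    · have : f (s - q) = 0 := by
        refine hf ?_
        exact AffineSubspace.vsub_mem_direction (subset_affineSpan ℝ S hs)
          (subset_affineSpan ℝ S hq)
      rw [hab] at this
      exact this.le

/-- The supporting half-plane contains the hull, and an arbitrarily small move of `q` along the
normal `(a, b)` leaves it. -/
theorem notMem_interior_of_supports {S : Set (ℝ × ℝ)} {q : ℝ × ℝ} {a b : ℝ}
    (hab : a ≠ 0 ∨ b ≠ 0) (h : Supports a b S q) : q ∉ interior (convexHull ℝ S) := by
  intro hq
  have hhull : convexHull ℝ S ⊆ {z | a * z.1 + b * z.2 ≤ a * q.1 + b * q.2} := by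
    refine convexHull_min (fun s hs => ?_) ?_
    · have := h s hs
      show a * s.1 + b * s.2 ≤ a * q.1 + b * q.2
      linarith
    · exact convex_halfSpace_le ⟨fun x y => by simp; ring, fun c x => by simp; ring⟩ _
  have hcont : Filter.Tendsto (fun ε : ℝ => (q.1 + ε * a, q.2 + ε * b)) (nhds 0) (nhds q) := by
    have : Continuous fun ε : ℝ => (q.1 + ε * a, q.2 + ε * b) := by fun_prop
    simpa using this.tendsto 0
  have hev := (hcont.eventually (mem_interior_iff_mem_nhds.1 hq)).filter_mono
    (nhdsWithin_le_nhds (s := Ioi 0))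
  obtain ⟨ε, hε, hpos⟩ := (hev.and self_mem_nhdsWithin).exists
  have h1 : a * (q.1 + ε * a) + b * (q.2 + ε * b) ≤ a * q.1 + b * q.2 := hhull hε
  have hpos' : 0 < ε := hpos
  have : 0 < a * a + b * b := by
    rcases hab with h | h
    · have := mul_self_pos.2 h; have := mul_self_nonneg b; linarith
    · have := mul_self_pos.2 h; have := mul_self_nonneg a; linarith
  nlinarith [mul_pos hpos' this]

/-- The hull of a finite set is closed, so its frontier is the hull minus the interior. This turns
the topological condition into linear inequalities the machine can test. -/
theorem mem_frontier_convexHull_iff {S : Set (ℝ × ℝ)} (hS : S.Finite) {q : ℝ × ℝ}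
    (hq : q ∈ S) :
    q ∈ frontier (convexHull ℝ S) ↔ ∃ a b, (a ≠ 0 ∨ b ≠ 0) ∧ Supports a b S q := by
  rw [(hS.isClosed_convexHull ℝ).frontier_eq]
  constructor
  · exact fun h => exists_supports_of_notMem_interior hq h.2
  · rintro ⟨a, b, hab, h⟩
    exact ⟨subset_convexHull ℝ S hq, notMem_interior_of_supports hab h⟩

/-! ### Points that cannot lie on the boundary -/

/-- Each of the four open quadrants at `q` contains a point of `S`. -/
def Surrounded (S : Set (ℝ × ℝ)) (q : ℝ × ℝ) : Prop :=
  (∃ s ∈ S, s.1 < q.1 ∧ s.2 < q.2) ∧ (∃ s ∈ S, q.1 < s.1 ∧ s.2 < q.2) ∧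
    (∃ s ∈ S, s.1 < q.1 ∧ q.2 < s.2) ∧ ∃ s ∈ S, q.1 < s.1 ∧ q.2 < s.2

/-- The signs of `a` and `b` select an open quadrant on which the functional is positive. -/
theorem Surrounded.exists_lt {S : Set (ℝ × ℝ)} {q : ℝ × ℝ} (h : Surrounded S q) {a b : ℝ}
    (hab : a ≠ 0 ∨ b ≠ 0) : ∃ s ∈ S, 0 < a * (s.1 - q.1) + b * (s.2 - q.2) := by
  obtain ⟨⟨s₁, h₁, h₁x, h₁y⟩, ⟨s₂, h₂, h₂x, h₂y⟩, ⟨s₃, h₃, h₃x, h₃y⟩, ⟨s₄, h₄, h₄x, h₄y⟩⟩ := h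
  rcases le_or_gt a 0 with ha | ha <;> rcases le_or_gt b 0 with hb | hb
  · refine ⟨s₁, h₁, ?_⟩
    rcases hab with h | h
    · have := mul_pos_of_neg_of_neg (lt_of_le_of_ne ha h) (sub_neg.2 h₁x)
      have := mul_nonneg_of_nonpos_of_nonpos hb (sub_neg.2 h₁y).le
      linarith
    · have := mul_pos_of_neg_of_neg (lt_of_le_of_ne hb h) (sub_neg.2 h₁y)
      have := mul_nonneg_of_nonpos_of_nonpos ha (sub_neg.2 h₁x).le
      linarith
  · refine ⟨s₃, h₃, ?_⟩
    have := mul_nonneg_of_nonpos_of_nonpos ha (sub_neg.2 h₃x).le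
    have := mul_pos hb (sub_pos.2 h₃y)
    linarith
  · refine ⟨s₂, h₂, ?_⟩
    have := mul_nonneg_of_nonpos_of_nonpos hb (sub_neg.2 h₂y).le
    have := mul_pos ha (sub_pos.2 h₂x)
    linarith
  · refine ⟨s₄, h₄, ?_⟩
    have := mul_pos hb (sub_pos.2 h₄y)
    have := mul_pos ha (sub_pos.2 h₄x)
    linarith

theorem Surrounded.notMem_frontier {S : Set (ℝ × ℝ)} (hS : S.Finite) {q : ℝ × ℝ}
    (hq : q ∈ S) (h : Surrounded S q) : q ∉ frontier (convexHull ℝ S) := by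
  rw [mem_frontier_convexHull_iff hS hq]
  rintro ⟨a, b, hab, hsup⟩
  obtain ⟨s, hs, hlt⟩ := h.exists_lt hab
  exact absurd (hsup s hs) hlt.not_ge

/-- Surrounded points may be thrown away. -/
theorem supports_of_subset {S K : Set (ℝ × ℝ)} (hS : S.Finite)
    (hKS : ∀ s ∈ S, s ∈ K ∨ Surrounded S s) {q : ℝ × ℝ} {a b : ℝ}
    (hab : a ≠ 0 ∨ b ≠ 0) (h : Supports a b K q) : Supports a b S q := by
  intro s hs
  -- A maximiser of the functional over `S` cannot be surrounded, so it lies in `K`, where the value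
  -- at `q` is an upper bound.
  obtain ⟨z, hz, hmax⟩ := hS.exists_maximalFor (fun s : ℝ × ℝ => a * s.1 + b * s.2) S ⟨s, hs⟩
  have hmax' : ∀ w ∈ S, a * w.1 + b * w.2 ≤ a * z.1 + b * z.2 := fun w hw =>
    (le_total _ _).elim id fun hle => hmax hw hle
  rcases hKS z hz with hk | hsur
  · have := h z hk
    have := hmax' s hs
    linarith
  · obtain ⟨w, hw, hlt⟩ := hsur.exists_lt hab
    have := hmax' w hw
    linarith

/-! ### Deciding the existence of a supporting line by greatest slopes -/

/-- A half-plane through the origin contains the vectors `v k`, and not as a lower one. -/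
def UpperSupport (dx dy : ℕ → ℝ) (m : ℕ) : Prop :=
  ∃ a b : ℝ, (0 < b ∨ b = 0 ∧ 0 < a) ∧ ∀ k < m, a * dx k + b * dy k ≤ 0

/-- Of a nonzero normal and its negative exactly one is admissible in `UpperSupport`; passing to the
negative amounts to negating all difference vectors. Hence two runs of one test suffice. -/
theorem exists_supports_iff {X Y : ℕ → ℝ} {m : ℕ} {q : ℝ × ℝ} :
    (∃ a b, (a ≠ 0 ∨ b ≠ 0) ∧ Supports a b {z | ∃ k < m, (X k, Y k) = z} q) ↔
      UpperSupport (fun k => X k - q.1) (fun k => Y k - q.2) m ∨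
        UpperSupport (fun k => q.1 - X k) (fun k => q.2 - Y k) m := by
  have hsup : ∀ a b, Supports a b {z | ∃ k < m, (X k, Y k) = z} q ↔
      ∀ k < m, a * (X k - q.1) + b * (Y k - q.2) ≤ 0 := by
    intro a b
    constructor
    · exact fun h k hk => h _ ⟨k, hk, rfl⟩
    · rintro h _ ⟨k, hk, rfl⟩
      exact h k hk
  simp only [hsup]
  constructor
  · rintro ⟨a, b, hab, h⟩
    by_cases hb : 0 < b ∨ b = 0 ∧ 0 < a
    · exact Or.inl ⟨a, b, hb, h⟩
    · refine Or.inr ⟨-a, -b, ?_, fun k hk => by linarith [h k hk]⟩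
      push Not at hb
      rcases lt_or_eq_of_le hb.1 with h | h
      · left; linarith
      · right
        have h0 : a ≠ 0 := by tauto
        have := lt_of_le_of_ne (hb.2 h) h0
        constructor <;> linarith
  · rintro (⟨a, b, hab, h⟩ | ⟨a, b, hab, h⟩)
    · exact ⟨a, b, hab.elim (fun h => Or.inr h.ne') (fun h => Or.inl h.2.ne'), h⟩
    · refine ⟨-a, -b, ?_, fun k hk => by linarith [h k hk]⟩
      exact hab.elim (fun h => Or.inr (by linarith : -b < 0).ne)
        fun h => Or.inl (by linarith [h.2] : -a < 0).ne

/-- `(w₁, w₂)` is the vector of greatest slope among the vectors `(dx k, dy k)`, `k < m`, with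
`0 < dx k`; it is `(0, -1)` if there are none. -/
def MaxSlope (dx dy : ℕ → ℝ) (m : ℕ) (w₁ w₂ : ℝ) : Prop :=
  (w₁ = 0 ∧ w₂ = -1 ∨ 0 < w₁ ∧ ∃ k < m, w₁ = dx k ∧ w₂ = dy k) ∧
    ∀ k < m, 0 < dx k → w₁ * dy k ≤ w₂ * dx k

theorem MaxSlope.zero (dx dy : ℕ → ℝ) : MaxSlope dx dy 0 0 (-1) :=
  ⟨Or.inl ⟨rfl, rfl⟩, fun k hk => absurd hk (Nat.not_lt_zero k)⟩

/-- Slopes are compared by cross-multiplication. The sentinel `(0, -1)` plays the role of slope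
`-∞`: for it `hw` just says `0 < dx m`, and no earlier vector has positive abscissa. -/
theorem MaxSlope.update {dx dy : ℕ → ℝ} {m : ℕ} {w₁ w₂ : ℝ} (h : MaxSlope dx dy m w₁ w₂)
    (hx : 0 < dx m) (hw : w₂ * dx m < w₁ * dy m) : MaxSlope dx dy (m + 1) (dx m) (dy m) := by
  refine ⟨Or.inr ⟨hx, m, by omega, rfl, rfl⟩, fun k hk hkx => ?_⟩
  rcases Nat.lt_succ_iff_lt_or_eq.1 hk with hk | rfl
  · have hle := h.2 k hk hkx
    rcases h.1 with ⟨rfl, rfl⟩ | ⟨hw₁, -⟩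
    · linarith
    · have h₁ := mul_le_mul_of_nonneg_left hle hx.le
      have h₂ := mul_lt_mul_of_pos_left hw hkx
      have : w₁ * (dx m * dy k) ≤ w₁ * (dy m * dx k) := by nlinarith
      exact le_of_mul_le_mul_left this hw₁
  · rw [mul_comm]

theorem MaxSlope.keep {dx dy : ℕ → ℝ} {m : ℕ} {w₁ w₂ : ℝ} (h : MaxSlope dx dy m w₁ w₂)
    (hw : ¬ (0 < dx m ∧ w₂ * dx m < w₁ * dy m)) : MaxSlope dx dy (m + 1) w₁ w₂ := by
  refine ⟨h.1.imp id fun ⟨h₁, k, hk, h₂⟩ => ⟨h₁, k, by omega, h₂⟩, fun k hk hkx => ?_⟩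
  rcases Nat.lt_succ_iff_lt_or_eq.1 hk with hk | rfl
  · exact h.2 k hk hkx
  · by_contra! hlt
    exact hw ⟨hkx, hlt⟩

/-- If some upper half-plane contains all vectors, its boundary can be rotated until its right half
meets the steepest vector `w`: this lowers the boundary on the right, down to the greatest slope,
and raises it on the left. So only the line along `w` has to be tested. -/
theorem MaxSlope.upperSupport_iff {dx dy : ℕ → ℝ} {m : ℕ} {w₁ w₂ : ℝ}
    (h : MaxSlope dx dy m w₁ w₂) :
    UpperSupport dx dy m ↔ ∀ k < m, ¬ w₂ * dx k < w₁ * dy k := by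
  constructor
  · rintro ⟨a, b, hab, hsup⟩ k hk
    rw [not_lt]
    rcases h.1 with ⟨rfl, rfl⟩ | ⟨hw, l, hl, rfl, rfl⟩
    · by_contra! hlt
      have := h.2 k hk (by linarith)
      linarith
    · have hk' := hsup k hk
      have hl' := hsup l hl
      rcases lt_or_ge 0 (dx k) with hx | hx
      · exact h.2 k hk hx
      · rcases hab with hb | ⟨rfl, ha⟩
        · have h₁ := mul_le_mul_of_nonneg_left hk' hw.le
          have h₂ := mul_le_mul_of_nonpos_left hl' hx
          have : b * (dx l * dy k) ≤ b * (dy l * dx k) := by nlinarith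
          exact le_of_mul_le_mul_left this hb
        · have := mul_pos ha hw
          linarith
  · intro hk
    rcases h.1 with ⟨rfl, rfl⟩ | ⟨hw, -⟩
    -- With the sentinel, the test says that no vector has positive abscissa, so the vertical line
    -- works.
    · exact ⟨1, 0, Or.inr ⟨rfl, one_pos⟩, fun k hk' => by linarith [hk k hk']⟩
    · exact ⟨-w₂, w₁, Or.inl hw, fun k hk' => by linarith [hk k hk']⟩

/-! ### The number of points near a corner of the unit square -/

/-- The uniform distribution on the unit interval. -/
noncomputable abbrev uniformReal : Measure ℝ := volume.restrict (Icc 0 1)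

/-- The uniform distribution on the unit square. -/
noncomputable abbrev uniformPoint : Measure (ℝ × ℝ) := uniformReal.prod uniformReal

theorem uniformPoints_eq (n : ℕ) : uniformPoints n = Measure.pi fun _ => uniformPoint := by
  unfold uniformPoints uniformPoint uniformReal
  rw [Measure.prod_restrict, ← Measure.volume_eq_prod]

instance : IsProbabilityMeasure uniformReal := ⟨by simp⟩

instance (n : ℕ) : IsProbabilityMeasure (uniformPoints n) := by
  rw [uniformPoints_eq]
  infer_instance

theorem lintegral_mul_pow_one_sub_sq (N : ℕ) :
    ∫⁻ s, ENNReal.ofReal (s * (1 - s ^ 2) ^ N) ∂uniformReal = ENNReal.ofReal (1 / (2 * (N + 1))) := by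
  have hN : (N : ℝ) + 1 ≠ 0 := by positivity
  have hcont : Continuous fun s : ℝ => s * (1 - s ^ 2) ^ N := by fun_prop
  rw [← ofReal_integral_eq_lintegral_ofReal]
  · congr 1
    rw [integral_Icc_eq_integral_Ioc, ← intervalIntegral.integral_of_le zero_le_one]
    have hderiv : ∀ s ∈ uIcc (0 : ℝ) 1,
        HasDerivAt (fun s : ℝ => -(1 - s ^ 2) ^ (N + 1) / (2 * (N + 1))) (s * (1 - s ^ 2) ^ N) s := by
      intro s _
      have h := ((((hasDerivAt_id s).pow 2).const_sub 1).pow (N + 1)).neg.div_const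
        (2 * ((N : ℝ) + 1))
      refine HasDerivAt.congr_deriv h ?_
      simp
      field_simp
    rw [intervalIntegral.integral_eq_sub_of_hasDerivAt hderiv
      (hcont.intervalIntegrable 0 1)]
    simp
    field_simp
  · exact hcont.integrableOn_Icc
  · refine (ae_restrict_mem measurableSet_Icc).mono fun s hs => ?_
    have : 0 ≤ 1 - s ^ 2 := by nlinarith [hs.1, hs.2]
    have := hs.1
    positivity

theorem uniformReal_Iic_le {s : ℝ} : uniformReal (Iic s) ≤ ENNReal.ofReal s := by
  rw [Measure.restrict_apply measurableSet_Iic]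
  calc volume (Iic s ∩ Icc 0 1) ≤ volume (Icc 0 s) :=
        measure_mono fun x hx => ⟨hx.2.1, hx.1⟩
    _ = ENNReal.ofReal s := by simp

/-- The complement is a square of area `M ^ 2`. -/
theorem uniformPoint_max_ge_le {M : ℝ} (h₀ : 0 ≤ M) (h₁ : M ≤ 1) :
    uniformPoint {c | M ≤ max c.1 c.2} ≤ ENNReal.ofReal (1 - M ^ 2) := by
  have hc : {c : ℝ × ℝ | M ≤ max c.1 c.2} = (Iio M ×ˢ Iio M)ᶜ := by
    ext c
    simp only [mem_ofPred_eq, mem_compl_iff, mem_prod, mem_Iio, le_max_iff]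
    constructor
    · rintro h ⟨h₁, h₂⟩
      exact h.elim (fun h => h.not_gt h₁) fun h => h.not_gt h₂
    · intro h
      by_contra! hlt
      exact h hlt
  have hv : uniformReal (Iio M) = ENNReal.ofReal M := by
    rw [Measure.restrict_apply measurableSet_Iio]
    have : Iio M ∩ Icc 0 1 = Ico 0 M := by
      ext x
      simp only [mem_inter_iff, mem_Iio, mem_Icc, mem_Ico]
      constructor
      · rintro ⟨h, h', -⟩
        exact ⟨h', h⟩
      · rintro ⟨h, h'⟩
        exact ⟨h', h, by linarith⟩
    rw [this]
    simp
  rw [hc, prob_compl_eq_one_sub (measurableSet_Iio.prod measurableSet_Iio), Measure.prod_prod,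
    hv, ENNReal.ofReal_sub _ (by positivity), ENNReal.ofReal_one, pow_two,
    ENNReal.ofReal_mul h₀]

/-- Only the abscissas `s`, `t` of `a`, `b` matter. Splitting according to the larger one gives two
equal halves; when `s` is the larger, `t` ranges over a set of measure at most `s`, which leaves the
integral of `s * (1 - s ^ 2) ^ N`. -/
theorem lintegral_max_le (N : ℕ) :
    ∫⁻ a, ∫⁻ b, uniformPoint {c | max a.1 b.1 ≤ max c.1 c.2} ^ N ∂uniformPoint ∂uniformPoint ≤
      ENNReal.ofReal (1 / (N + 1)) := by
  set g : ℝ → ℝ → ℝ≥0∞ := fun s t => uniformPoint {c | max s t ≤ max c.1 c.2} ^ N with hg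
  have hanti : Antitone fun M : ℝ => uniformPoint {c | M ≤ max c.1 c.2} ^ N := fun M M' h =>
    pow_le_pow_left₀ zero_le (measure_mono fun c hc => le_trans h hc) N
  have hgm : Measurable fun z : ℝ × ℝ => g z.1 z.2 :=
    hanti.measurable.comp (measurable_fst.max measurable_snd)
  have hfst : ∀ f : ℝ → ℝ≥0∞, Measurable f → ∫⁻ a, f a.1 ∂uniformPoint = ∫⁻ s, f s ∂uniformReal := by
    intro f hf
    rw [lintegral_prod (fun a : ℝ × ℝ => f a.1) (hf.comp measurable_fst).aemeasurable]
    simp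
  have h1 : ∀ a : ℝ × ℝ, ∫⁻ b, g a.1 b.1 ∂uniformPoint = ∫⁻ t, g a.1 t ∂uniformReal := fun a =>
    hfst (g a.1) (hgm.comp measurable_prodMk_left)
  simp only [hg] at h1
  simp only [h1]
  rw [hfst (fun s => ∫⁻ t, uniformPoint {c | max s t ≤ max c.1 c.2} ^ N ∂uniformReal)
    hgm.lintegral_prod_right']
  set f : ℝ → ℝ≥0∞ := fun s => ENNReal.ofReal ((1 - s ^ 2) ^ N) with hf
  have hfm : Measurable f := by fun_prop
  set F : ℝ → ℝ → ℝ≥0∞ := fun s t => (Iic s).indicator (fun _ => f s) t with hF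
  have hFm : Measurable fun z : ℝ × ℝ => F z.1 z.2 := by
    have : (fun z : ℝ × ℝ => F z.1 z.2) =
        {z : ℝ × ℝ | z.2 ≤ z.1}.indicator fun z => f z.1 := by
      ext z
      simp [F, indicator]
    rw [this]
    exact (hfm.comp measurable_fst).indicator (measurableSet_le measurable_snd measurable_fst)
  have hFint : ∫⁻ s, ∫⁻ t, F s t ∂uniformReal ∂uniformReal ≤
      ENNReal.ofReal (1 / (2 * (N + 1))) := by
    rw [← lintegral_mul_pow_one_sub_sq]
    refine lintegral_mono_ae ((ae_restrict_mem measurableSet_Icc).mono fun s hs => ?_)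
    rw [hF]
    simp only
    rw [lintegral_indicator_const measurableSet_Iic, mul_comm, ENNReal.ofReal_mul hs.1]
    exact mul_le_mul_left uniformReal_Iic_le _
  have hle : ∀ s ∈ Icc (0 : ℝ) 1, ∀ t ∈ Icc (0 : ℝ) 1, g s t ≤ F s t + F t s := by
    intro s hs t ht
    have key : ∀ M ∈ Icc (0 : ℝ) 1, uniformPoint {c | M ≤ max c.1 c.2} ^ N ≤ f M := by
      intro M hM
      have : 0 ≤ 1 - M ^ 2 := by nlinarith [hM.1, hM.2]
      rw [hf]
      simp only
      rw [ENNReal.ofReal_pow this]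
      exact pow_le_pow_left₀ zero_le (uniformPoint_max_ge_le hM.1 hM.2) N
    rcases le_total t s with h | h
    · refine le_add_right ?_
      simp only [hg, hF, max_eq_left h, indicator, mem_Iic, h, if_true]
      exact key s hs
    · refine le_add_left ?_
      simp only [hg, hF, max_eq_right h, indicator, mem_Iic, h, if_true]
      exact key t ht
  calc ∫⁻ s, ∫⁻ t, g s t ∂uniformReal ∂uniformReal
      ≤ ∫⁻ s, ∫⁻ t, (F s t + F t s) ∂uniformReal ∂uniformReal :=
        lintegral_mono_ae ((ae_restrict_mem measurableSet_Icc).mono fun s hs =>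
          lintegral_mono_ae ((ae_restrict_mem measurableSet_Icc).mono fun t ht => hle s hs t ht))
    _ = ∫⁻ s, ∫⁻ t, F s t ∂uniformReal ∂uniformReal +
          ∫⁻ s, ∫⁻ t, F t s ∂uniformReal ∂uniformReal := by
        rw [← lintegral_add_left hFm.lintegral_prod_right']
        refine lintegral_congr fun s => ?_
        exact lintegral_add_left (hFm.comp measurable_prodMk_left) _
    _ = ∫⁻ s, ∫⁻ t, F s t ∂uniformReal ∂uniformReal +
          ∫⁻ s, ∫⁻ t, F s t ∂uniformReal ∂uniformReal := by
        congr 1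
        exact lintegral_lintegral_swap (hFm.comp measurable_swap).aemeasurable
    _ ≤ ENNReal.ofReal (1 / (2 * (N + 1))) + ENNReal.ofReal (1 / (2 * (N + 1))) :=
        add_le_add hFint hFint
    _ = ENNReal.ofReal (1 / (N + 1)) := by
        rw [← ENNReal.ofReal_add (by positivity) (by positivity)]
        congr 1
        field_simp
        norm_num

/-- Fix the points `i` and `j` and drop the conditions on these two: the other `N` points are
independent, so the conditional probability is an `N`-th power. -/
theorem uniformPoints_add_two_pair_le (N : ℕ) {i j : Fin (N + 2)} (hij : j ≠ i) :
    uniformPoints (N + 2) {p | ∀ k, max (p i).1 (p j).1 ≤ max (p k).1 (p k).2} ≤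
      ENNReal.ofReal (1 / (N + 1)) := by
  obtain ⟨j, rfl⟩ := Fin.exists_succAbove_eq hij
  rw [uniformPoints_eq]
  have h₁ := measurePreserving_piFinSuccAbove (fun _ : Fin (N + 2) => uniformPoint) i
  have h₂ := measurePreserving_piFinSuccAbove (fun _ : Fin (N + 1) => uniformPoint) j
  set B : Set ((ℝ × ℝ) × (ℝ × ℝ) × (Fin N → ℝ × ℝ)) :=
    {z | ∀ l, max z.1.1 z.2.1.1 ≤ max (z.2.2 l).1 (z.2.2 l).2} with hB
  have hBm : MeasurableSet B := by
    rw [hB, ofPred_forall]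
    refine MeasurableSet.iInter fun l => measurableSet_le ?_ ?_ <;> fun_prop
  have h := ((MeasurePreserving.id uniformPoint).prod h₂).comp h₁
  calc Measure.pi (fun _ => uniformPoint)
        {p : Fin (N + 2) → ℝ × ℝ | ∀ k, max (p i).1 (p (i.succAbove j)).1 ≤ max (p k).1 (p k).2}
      ≤ Measure.pi (fun _ => uniformPoint) (_ ⁻¹' B) :=
        measure_mono fun p hp l => hp (i.succAbove (j.succAbove l))
    _ = _ := h.measure_preimage hBm.nullMeasurableSet
    _ ≤ _ := ?_
  rw [Measure.prod_apply hBm]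
  refine le_trans (lintegral_mono fun a => ?_) (lintegral_max_le N)
  rw [Measure.prod_apply (measurable_prodMk_left hBm)]
  refine lintegral_mono fun b => ?_
  have : Prod.mk b ⁻¹' (Prod.mk a ⁻¹' B) =
      univ.pi fun _ : Fin N => {c : ℝ × ℝ | max a.1 b.1 ≤ max c.1 c.2} := by
    ext c
    simp [hB]
  rw [this, Measure.pi_pi]
  simp

theorem uniformPoints_pair_le {n : ℕ} {i j : Fin n} (hij : j ≠ i) :
    uniformPoints n {p | ∀ k, max (p i).1 (p j).1 ≤ max (p k).1 (p k).2} ≤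
      ENNReal.ofReal (1 / ((n : ℝ) - 1)) := by
  match n with
  | 0 => exact i.elim0
  | 1 => exact absurd (Subsingleton.elim j i) hij
  | N + 2 =>
    refine (uniformPoints_add_two_pair_le N hij).trans_eq ?_
    push_cast
    ring_nf

/-! ### The second moment of the number of points near an axis -/

open Classical in
/-- The points whose abscissa is, in the coordinates given by `φ`, at most the distance of the
origin to each point. -/
noncomputable def nearAxis (φ : ℝ × ℝ → ℝ × ℝ) {n : ℕ} (p : Fin n → ℝ × ℝ) : Finset (Fin n) :=
  {i | ∀ k, (φ (p i)).1 ≤ max (φ (p k)).1 (φ (p k)).2}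

/-- The square counts ordered pairs. For each `i` the diagonal pair contributes at most 1, and the
other `n - 1` pairs at most `1 / (n - 1)` each. -/
theorem lintegral_card_nearAxis_id_le (n : ℕ) :
    ∫⁻ p, ((nearAxis id p).card : ℝ≥0∞) ^ 2 ∂uniformPoints n ≤ 2 * n := by
  classical
  set E : Fin n → Set (Fin n → ℝ × ℝ) := fun i => {p | ∀ k, (p i).1 ≤ max (p k).1 (p k).2}
  have hE : ∀ i, MeasurableSet (E i) := by
    intro i
    simp only [E]
    rw [ofPred_forall]
    refine MeasurableSet.iInter fun k => measurableSet_le ?_ ?_ <;> fun_prop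
  have hcard : ∀ p : Fin n → ℝ × ℝ, ((nearAxis id p).card : ℝ≥0∞) ^ 2 =
      ∑ i, ∑ j, (E i ∩ E j).indicator 1 p := by
    intro p
    have : ((nearAxis id p).card : ℝ≥0∞) = ∑ i, (E i).indicator (1 : (Fin n → ℝ × ℝ) → ℝ≥0∞) p := by
      simp only [nearAxis, E, indicator, Finset.card_filter, id, mem_ofPred_eq, Pi.one_apply]
      push_cast
      rfl
    rw [this, pow_two, Finset.sum_mul_sum]
    refine Finset.sum_congr rfl fun i _ => Finset.sum_congr rfl fun j _ => ?_
    rw [inter_indicator_one]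
    rfl
  have hpair : ∀ i j, i ≠ j →
      uniformPoints n (E i ∩ E j) ≤ ENNReal.ofReal (1 / ((n : ℝ) - 1)) := by
    intro i j hij
    exact le_trans (measure_mono fun p hp k => max_le (hp.1 k) (hp.2 k))
      (uniformPoints_pair_le hij.symm)
  have hrow : ∀ i, ∑ j, uniformPoints n (E i ∩ E j) ≤ 2 := by
    intro i
    rw [← Finset.add_sum_erase _ _ (Finset.mem_univ i), ← one_add_one_eq_two]
    refine add_le_add prob_le_one ?_
    calc ∑ j ∈ Finset.univ.erase i, uniformPoints n (E i ∩ E j)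
        ≤ ∑ j ∈ Finset.univ.erase i, ENNReal.ofReal (1 / ((n : ℝ) - 1)) :=
          Finset.sum_le_sum fun j hj => hpair i j (Finset.ne_of_mem_erase hj).symm
      _ = ENNReal.ofReal (((n - 1 : ℕ) : ℝ) * (1 / ((n : ℝ) - 1))) := by
          rw [Finset.sum_const, Finset.card_erase_of_mem (Finset.mem_univ i), Finset.card_univ,
            Fintype.card_fin, nsmul_eq_mul, ENNReal.ofReal_mul (by positivity),
            ENNReal.ofReal_natCast]
      _ ≤ 1 := by
          rw [← ENNReal.ofReal_one]
          refine ENNReal.ofReal_le_ofReal ?_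
          rw [Nat.cast_sub (Nat.one_le_of_lt i.2), Nat.cast_one, mul_one_div]
          -- An inequality, since the quotient is `0 / 0 = 0` for `n = 1`.
          exact div_self_le_one _
  simp only [hcard]
  rw [lintegral_finsetSum]
  · calc ∑ i, ∫⁻ p, ∑ j, (E i ∩ E j).indicator 1 p ∂uniformPoints n
        = ∑ i, ∑ j, uniformPoints n (E i ∩ E j) := by
          refine Finset.sum_congr rfl fun i _ => ?_
          rw [lintegral_finsetSum]
          · exact Finset.sum_congr rfl fun j _ => lintegral_indicator_one ((hE i).inter (hE j))
          · exact fun j _ => measurable_one.indicator ((hE i).inter (hE j))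
      _ ≤ ∑ _i : Fin n, 2 := Finset.sum_le_sum fun i _ => hrow i
      _ = 2 * n := by simp [mul_comm]
  · exact fun i _ => Finset.measurable_sum _ fun j _ =>
      measurable_one.indicator ((hE i).inter (hE j))

theorem measurable_card_nearAxis {φ : ℝ × ℝ → ℝ × ℝ} (hφ : Measurable φ) (n : ℕ) :
    Measurable fun p : Fin n → ℝ × ℝ => ((nearAxis φ p).card : ℝ≥0∞) := by
  classical
  simp only [nearAxis, Finset.card_filter]
  push_cast
  refine Finset.measurable_sum _ fun i _ => Measurable.ite ?_ measurable_const measurable_const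
  rw [ofPred_forall]
  refine MeasurableSet.iInter fun k => measurableSet_le ?_ ?_ <;> fun_prop

/-- Applying `φ` to every point preserves the joint law and reduces to the identity. -/
theorem lintegral_card_nearAxis_le {φ : ℝ × ℝ → ℝ × ℝ}
    (hφ : MeasurePreserving φ uniformPoint uniformPoint) (n : ℕ) :
    ∫⁻ p, ((nearAxis φ p).card : ℝ≥0∞) ^ 2 ∂uniformPoints n ≤ 2 * n := by
  refine le_trans (le_of_eq ?_) (lintegral_card_nearAxis_id_le n)
  have h : MeasurePreserving (fun (p : Fin n → ℝ × ℝ) i => φ (p i))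
      (uniformPoints n) (uniformPoints n) := by
    rw [uniformPoints_eq]
    exact measurePreserving_pi _ _ fun _ => hφ
  exact h.lintegral_comp ((measurable_card_nearAxis measurable_id n).pow_const 2)

/-! ### Symmetries of the unit square -/

/-- The reflection of the unit interval if `b` holds. -/
noncomputable def unitFlip (b : Bool) (x : ℝ) : ℝ := if b then 1 - x else x

/-- The symmetries of the unit square. -/
noncomputable def squareSymm (σ : Bool × Bool × Bool) (z : ℝ × ℝ) : ℝ × ℝ :=
  if σ.2.2 then (unitFlip σ.2.1 z.2, unitFlip σ.1 z.1) else (unitFlip σ.1 z.1, unitFlip σ.2.1 z.2)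

theorem measurePreserving_unitFlip (b : Bool) :
    MeasurePreserving (unitFlip b) uniformReal uniformReal := by
  cases b
  · exact MeasurePreserving.id _
  · have h := (Measure.measurePreserving_sub_left (volume : Measure ℝ) 1).restrict_preimage
      (measurableSet_Icc (a := (0 : ℝ)) (b := 1))
    simp only [preimage_const_sub_Icc, sub_self, sub_zero] at h
    exact h

theorem measurePreserving_squareSymm (σ : Bool × Bool × Bool) :
    MeasurePreserving (squareSymm σ) uniformPoint uniformPoint := by
  obtain ⟨a, b, c⟩ := σ
  have h := (measurePreserving_unitFlip a).prod (measurePreserving_unitFlip b)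
  cases c
  · exact h
  · exact Measure.measurePreserving_swap.comp h

/-- Cauchy–Schwarz over the eight symmetries: `8 * (8 * 2 * n) = 128 * n`. -/
theorem lintegral_sq_le_of_le_sum_nearAxis {n : ℕ} {m : (Fin n → ℝ × ℝ) → ℕ}
    (hm : ∀ p, m p ≤ ∑ σ, (nearAxis (squareSymm σ) p).card) :
    ∫⁻ p, (m p : ℝ≥0∞) ^ 2 ∂uniformPoints n ≤ 128 * n := by
  have hle : ∀ p, (m p : ℝ≥0∞) ^ 2 ≤
      8 * ∑ σ, ((nearAxis (squareSymm σ) p).card : ℝ≥0∞) ^ 2 := by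
    intro p
    have h := sq_sum_le_card_mul_sum_sq (s := (Finset.univ : Finset (Bool × Bool × Bool)))
      (f := fun σ => (nearAxis (squareSymm σ) p).card)
    have h' : m p ^ 2 ≤ 8 * ∑ σ, (nearAxis (squareSymm σ) p).card ^ 2 :=
      (Nat.pow_le_pow_left (hm p) 2).trans (by simpa using h)
    exact_mod_cast h'
  calc ∫⁻ p, (m p : ℝ≥0∞) ^ 2 ∂uniformPoints n
      ≤ ∫⁻ p, 8 * ∑ σ, ((nearAxis (squareSymm σ) p).card : ℝ≥0∞) ^ 2 ∂uniformPoints n :=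
        lintegral_mono hle
    _ = 8 * ∑ σ, ∫⁻ p, ((nearAxis (squareSymm σ) p).card : ℝ≥0∞) ^ 2 ∂uniformPoints n := by
        have hmeas : ∀ σ, Measurable fun p : Fin n → ℝ × ℝ =>
            ((nearAxis (squareSymm σ) p).card : ℝ≥0∞) ^ 2 := fun σ =>
          (measurable_card_nearAxis (measurePreserving_squareSymm σ).measurable n).pow_const 2
        rw [lintegral_const_mul _ (Finset.measurable_sum _ fun σ _ => hmeas σ),
          lintegral_finsetSum _ fun σ _ => hmeas σ]
    _ ≤ 8 * ∑ _σ : Bool × Bool × Bool, 2 * (n : ℝ≥0∞) := by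
        gcongr with σ
        exact lintegral_card_nearAxis_le (measurePreserving_squareSymm σ) n
    _ = 128 * n := by
        simp
        ring

namespace RealRAM

@[simp] theorem setInt_real (s : Store) (a i v : ℕ) : (s.setInt a i v).real = s.real := rfl

@[simp] theorem setReal_int (s : Store) (a i : ℕ) (v : ℝ) : (s.setReal a i v).int = s.int := rfl

attribute [simp] setInt_int setReal_real IExp.eval RExp.eval BExp.Holds

/-- Cell `0` of a real array. -/
abbrev RExp.var (a : ℕ) : RExp := .get a (.lit 0)

/-- A bound for the running time of a program without loops. -/
def Cmd.bound : Cmd → ℕ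
  | .skip => 1
  | .iset _ i e => i.cost + e.cost + 1
  | .rset _ i e => i.cost + e.cost + 1
  | .seq c d => c.bound + d.bound
  | .ite b c d => b.cost + (c.bound + d.bound)
  | .loop _ _ => 0

/-! ### Running minima -/

/-- The minimum of the first values of `max (u k) (v k)`. -/
noncomputable def cornerDist (u v : ℕ → ℝ) : ℕ → ℝ
  | 0 => max (u 0) (v 0)
  | k + 1 => min (cornerDist u v k) (max (u k) (v k))

theorem cornerDist_le {u v : ℕ → ℝ} {n k : ℕ} (hk : k < n) :
    cornerDist u v n ≤ max (u k) (v k) := by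
  induction n with
  | zero => omega
  | succ n ih =>
    rcases Nat.lt_succ_iff_lt_or_eq.1 hk with h | rfl
    · exact (min_le_left _ _).trans (ih h)
    · exact min_le_right _ _

theorem exists_le_cornerDist (u v : ℕ → ℝ) {n : ℕ} (hn : 0 < n) :
    ∃ k < n, u k ≤ cornerDist u v n ∧ v k ≤ cornerDist u v n := by
  -- The running minimum starts from the entry `0` instead of `∞`, so for the induction the index
  -- `0` must be allowed even when `n = 0`.
  suffices H : ∀ n, ∃ k, (k < n ∨ k = 0) ∧ u k ≤ cornerDist u v n ∧ v k ≤ cornerDist u v n by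
    obtain ⟨k, hk, h⟩ := H n
    exact ⟨k, by omega, h⟩
  intro n
  induction n with
  | zero => exact ⟨0, Or.inr rfl, le_max_left _ _, le_max_right _ _⟩
  | succ n ih =>
    rw [cornerDist]
    rcases le_total (cornerDist u v n) (max (u n) (v n)) with hle | hle
    · rw [min_eq_left hle]
      obtain ⟨k, hk, h'⟩ := ih
      exact ⟨k, by omega, h'⟩
    · rw [min_eq_right hle]
      exact ⟨n, by omega, le_max_left _ _, le_max_right _ _⟩

/-- `r := max u v`. -/
def maxSet (r : ℕ) (u v : RExp) : Cmd :=
  .ite (.rlt u v) (.rset r (.lit 0) v) (.rset r (.lit 0) u)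

theorem runs_maxSet (r : ℕ) (u v : RExp) (s : Store) :
    Runs (maxSet r u v) s (maxSet r u v).bound fun s' =>
      s'.real r 0 = max (u.eval s) (v.eval s) := by
  refine Runs.ite (fun h => Runs.rset ?_) fun h => Runs.rset ?_
  · simp at h ⊢
    exact h.le
  · simp at h ⊢
    exact h

/-- `r := min r (max u v)`. -/
def minStep (r : ℕ) (u v : RExp) : Cmd :=
  .ite (.and (.rlt u (.var r)) (.rlt v (.var r))) (maxSet r u v) .skip

theorem runs_minStep (r : ℕ) (u v : RExp) (s : Store) :
    Runs (minStep r u v) s (minStep r u v).bound fun s' =>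
      s'.real r 0 = min (s.real r 0) (max (u.eval s) (v.eval s)) := by
  refine Runs.ite (fun h => (runs_maxSet r u v s).mono le_rfl fun s' _ h' => ?_)
    fun h => Runs.skip ?_
  · simp only [BExp.Holds, RExp.eval, IExp.eval] at h
    rw [h', min_eq_right (max_le h.1.le h.2.le)]
  · simp only [BExp.Holds, RExp.eval, IExp.eval] at h
    rw [min_eq_left]
    by_contra! hlt
    exact h ⟨(le_max_left _ _).trans_lt hlt, (le_max_right _ _).trans_lt hlt⟩

/-- The expression for `unitFlip b`. -/
def flipExp (b : Bool) (e : RExp) : RExp := if b then .sub (.lit 1) e else e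

@[simp] theorem eval_flipExp (b : Bool) (e : RExp) (s : Store) :
    (flipExp b e).eval s = unitFlip b (e.eval s) := by
  cases b <;> simp [flipExp, unitFlip]

/-- The real variable that belongs to a corner of the unit square. -/
def cornerVar (b c : Bool) : ℕ := 10 + 2 * b.toNat + c.toNat

/-- The step of `computeCorners` for one corner. -/
def cornerStep (b c : Bool) : Cmd :=
  minStep (cornerVar b c) (flipExp b (.get 0 (.var 3))) (flipExp c (.get 1 (.var 3)))

def cornerSteps : Cmd :=
  .seq (cornerStep false false) (.seq (cornerStep false true)
    (.seq (cornerStep true false) (cornerStep true true)))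

/-- The minimum starts from the point in cell `0`, which the loop meets again harmlessly. For `n =
0` the value read is meaningless but never used, as no point is tested. -/
def initCorner (b c : Bool) : Cmd :=
  maxSet (cornerVar b c) (flipExp b (.get 0 (.lit 0))) (flipExp c (.get 1 (.lit 0)))

def initCorners : Cmd :=
  .seq (initCorner false false) (.seq (initCorner false true)
    (.seq (initCorner true false) (initCorner true true)))

/-- Compute the distances of the four corners of the unit square from the input. -/
def computeCorners : Cmd :=
  .seq initCorners (.for 3 0 cornerSteps)

theorem runs_cornerStep (b c : Bool) (s : Store) :
    Runs (cornerStep b c) s (cornerStep b c).bound fun s' =>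
      s'.real (cornerVar b c) 0 = min (s.real (cornerVar b c) 0)
        (max (unitFlip b (s.real 0 (s.int 3 0))) (unitFlip c (s.real 1 (s.int 3 0)))) := by
  refine (runs_minStep _ _ _ s).mono le_rfl fun s' _ h => ?_
  simpa using h

theorem runs_cornerSteps (s : Store) :
    Runs cornerSteps s cornerSteps.bound fun s' => ∀ b c,
      s'.real (cornerVar b c) 0 = min (s.real (cornerVar b c) 0)
        (max (unitFlip b (s.real 0 (s.int 3 0))) (unitFlip c (s.real 1 (s.int 3 0)))) := by
  refine Runs.seq ((runs_cornerStep _ _ s).mono le_rfl fun s₁ f₁ h₁ => ?_)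
  refine Runs.seq ((runs_cornerStep _ _ s₁).mono le_rfl fun s₂ f₂ h₂ => ?_)
  refine Runs.seq ((runs_cornerStep _ _ s₂).mono le_rfl fun s₃ f₃ h₃ => ?_)
  refine (runs_cornerStep _ _ s₃).mono le_rfl fun s₄ f₄ h₄ => ?_
  have e₁ := f₁.int 3 (by decide)
  have e₂ := f₂.int 3 (by decide)
  have e₃ := f₃.int 3 (by decide)
  have x₁ := f₁.real 0 (by decide)
  have x₂ := f₂.real 0 (by decide)
  have x₃ := f₃.real 0 (by decide)
  have y₁ := f₁.real 1 (by decide)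
  have y₂ := f₂.real 1 (by decide)
  have y₃ := f₃.real 1 (by decide)
  rintro (_ | _) (_ | _)
  · rw [f₄.real _ (by decide), f₃.real _ (by decide), f₂.real _ (by decide), h₁]
  · rw [f₄.real _ (by decide), f₃.real _ (by decide), h₂, f₁.real (cornerVar _ _) (by decide),
      e₁, x₁, y₁]
  · rw [f₄.real _ (by decide), h₃, f₂.real (cornerVar _ _) (by decide),
      f₁.real (cornerVar _ _) (by decide), e₂, e₁, x₂, x₁, y₂, y₁]
  · rw [h₄, f₃.real (cornerVar _ _) (by decide), f₂.real (cornerVar _ _) (by decide),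
      f₁.real (cornerVar _ _) (by decide), e₃, e₂, e₁, x₃, x₂, x₁, y₃, y₂, y₁]

theorem runs_initCorner (b c : Bool) (s : Store) :
    Runs (initCorner b c) s (initCorner b c).bound fun s' =>
      s'.real (cornerVar b c) 0 = max (unitFlip b (s.real 0 0)) (unitFlip c (s.real 1 0)) := by
  refine (runs_maxSet _ _ _ s).mono le_rfl fun s' _ h => ?_
  simpa using h

theorem runs_initCorners (s : Store) :
    Runs initCorners s initCorners.bound fun s' => ∀ b c,
      s'.real (cornerVar b c) 0 = max (unitFlip b (s.real 0 0)) (unitFlip c (s.real 1 0)) := by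
  refine Runs.seq ((runs_initCorner _ _ s).mono le_rfl fun s₁ f₁ h₁ => ?_)
  refine Runs.seq ((runs_initCorner _ _ s₁).mono le_rfl fun s₂ f₂ h₂ => ?_)
  refine Runs.seq ((runs_initCorner _ _ s₂).mono le_rfl fun s₃ f₃ h₃ => ?_)
  refine (runs_initCorner _ _ s₃).mono le_rfl fun s₄ f₄ h₄ => ?_
  have x₁ := f₁.real 0 (by decide)
  have x₂ := f₂.real 0 (by decide)
  have x₃ := f₃.real 0 (by decide)
  have y₁ := f₁.real 1 (by decide)
  have y₂ := f₂.real 1 (by decide)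
  have y₃ := f₃.real 1 (by decide)
  rintro (_ | _) (_ | _)
  · rw [f₄.real _ (by decide), f₃.real _ (by decide), f₂.real _ (by decide), h₁]
  · rw [f₄.real _ (by decide), f₃.real _ (by decide), h₂, x₁, y₁]
  · rw [f₄.real _ (by decide), h₃, x₂, x₁, y₂, y₁]
  · rw [h₄, x₃, x₂, x₁, y₃, y₂, y₁]

/-- The value that `computeCorners` computes for a corner. -/
noncomputable def cornerVal (X Y : ℕ → ℝ) (n : ℕ) (b c : Bool) : ℝ :=
  cornerDist (fun k => unitFlip b (X k)) (fun k => unitFlip c (Y k)) n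

theorem runs_computeCorners (s : Store) :
    Runs computeCorners s ((s.int 0 0 + 1) * (initCorners.bound + cornerSteps.bound + 11))
      fun s' => ∀ b c,
        s'.real (cornerVar b c) 0 = cornerVal (s.real 0) (s.real 1) (s.int 0 0) b c := by
  refine Runs.mono (T := initCorners.bound + (s.int 0 0 * (cornerSteps.bound + 11) + 8)) ?_
    (by nlinarith) fun _ _ h => h
  refine Runs.seq ((runs_initCorners s).mono le_rfl fun s₀ f₀ h₀ => ?_)
  refine Runs.for (Inv := fun k s' => ∀ b c,
    s'.real (cornerVar b c) 0 = cornerVal (s.real 0) (s.real 1) k b c)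
    (by decide) (by rw [f₀.int 0 (by decide)]) (by decide) (by decide) (fun _ _ _ h => h) ?_ ?_
  · exact h₀
  · intro k hk s' f hi hI
    refine (runs_cornerSteps s').mono le_rfl fun s₁ _ h₁ b c => ?_
    have x := (f.real 0 (by decide)).trans (f₀.real 0 (by decide))
    have y := (f.real 1 (by decide)).trans (f₀.real 1 (by decide))
    rw [h₁, hI, hi, x, y]
    rfl

/-! ### Appending a point to a list -/

/-- Append the point `(x, y)` to the list of length `l` in the real arrays `a` and `b`. -/
def append (a b l : ℕ) (x y : RExp) : Cmd :=
  .seq (.rset a (.var l) x) (.seq (.rset b (.var l) y)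
    (.iset l (.lit 0) (.add (.var l) (.lit 1))))

/-- The point with index `k` in the list in the real arrays `a` and `b`. -/
def Store.point (s : Store) (a b k : ℕ) : ℝ × ℝ := (s.real a k, s.real b k)

/-- `hy` is needed because `y` is evaluated after `x` has been written. -/
theorem runs_append {a b l : ℕ} {x y : RExp} {s : Store} (hab : a ≠ b)
    (hy : ∀ v, y.eval (s.setReal a (s.int l 0) v) = y.eval s) :
    Runs (append a b l x y) s (append a b l x y).bound fun s' =>
      s'.int l 0 = s.int l 0 + 1 ∧ (∀ k < s.int l 0, s'.point a b k = s.point a b k) ∧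
        s'.point a b (s.int l 0) = (x.eval s, y.eval s) := by
  refine Runs.seq (Runs.rset (Runs.seq (Runs.rset (Runs.iset ⟨?_, fun k hk => ?_, ?_⟩))))
  · simp
  · simp [Store.point, hk.ne]
  · simp [Store.point, hab, hy]

/-! ### Throwing points away -/

/-- The point `(x, y)` is farther from all sides of the unit square than the thresholds `D`. -/
def IsInner (D : Bool → Bool → ℝ) (z : ℝ × ℝ) : Prop :=
  ∀ b c, D b c < unitFlip b z.1 ∧ D b c < unitFlip c z.2

def innerCornerTest (b c : Bool) : BExp :=
  .and (.rlt (.var (cornerVar b c)) (flipExp b (.get 0 (.var 3))))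
    (.rlt (.var (cornerVar b c)) (flipExp c (.get 1 (.var 3))))

def innerTest : BExp :=
  .and (.and (innerCornerTest false false) (innerCornerTest false true))
    (.and (innerCornerTest true false) (innerCornerTest true true))

theorem holds_innerTest (s : Store) : innerTest.Holds s ↔
    IsInner (fun b c => s.real (cornerVar b c) 0) (s.point 0 1 (s.int 3 0)) := by
  simp [innerTest, innerCornerTest, IsInner, Bool.forall_bool, Store.point]

/-- Copy the points that are not `IsInner`. -/
def throwAwayBody : Cmd :=
  .ite innerTest .skip (append 4 5 2 (.get 0 (.var 3)) (.get 1 (.var 3)))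

def throwAway : Cmd := .for 3 0 throwAwayBody

-- The cardinality governs the later cost; the set of points governs correctness. Being inner
-- depends only on the coordinates, so copies of a point are kept or discarded together.
open Classical in
theorem runs_throwAway (s : Store) (hm : s.int 2 0 = 0) {D : Bool → Bool → ℝ}
    (hD : ∀ b c, s.real (cornerVar b c) 0 = D b c) :
    Runs throwAway s ((s.int 0 0 + 1) * (throwAwayBody.bound + 11)) fun s' =>
      s'.int 2 0 = ((Finset.range (s.int 0 0)).filter fun k => ¬ IsInner D (s.point 0 1 k)).card ∧
      ∀ z, (∃ k < s'.int 2 0, s'.point 4 5 k = z) ↔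
        ∃ k < s.int 0 0, s.point 0 1 k = z ∧ ¬ IsInner D z := by
  refine Runs.mono (T := s.int 0 0 * (throwAwayBody.bound + 11) + 8)
    (Runs.for (Inv := fun n s' =>
      s'.int 2 0 = ((Finset.range n).filter fun k => ¬ IsInner D (s.point 0 1 k)).card ∧
      ∀ z, (∃ k < s'.int 2 0, s'.point 4 5 k = z) ↔ ∃ k < n, s.point 0 1 k = z ∧ ¬ IsInner D z)
      (by decide) rfl (by decide) (by decide) ?_ ?_ ?_) (by nlinarith) fun _ _ h => h
  · intro k s v h
    simpa [Store.point] using h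
  · simp [hm]
  · intro n hn s' f hi ⟨hc, hp⟩
    have hx := f.real 0 (by decide)
    have hy := f.real 1 (by decide)
    have hpt : s'.point 0 1 (s'.int 3 0) = s.point 0 1 n := by
      simp [Store.point, hx, hy, hi]
    have hD' : (fun b c => s'.real (cornerVar b c) 0) = D := by
      ext b c
      rw [← hD b c, f.real _ (by cases b <;> cases c <;> decide)]
    refine Runs.ite (fun hin => Runs.skip ?_) fun hin =>
      (runs_append (by decide) (by simp)).mono le_rfl fun s₁ _ ⟨h₁, h₂, h₃⟩ => ?_
    · rw [holds_innerTest, hpt, hD'] at hin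
      refine ⟨?_, fun z => ?_⟩
      · rw [hc, Finset.range_add_one, Finset.filter_insert, if_neg (not_not.2 hin)]
      · rw [hp]
        constructor
        · rintro ⟨k, hk, h⟩
          exact ⟨k, by omega, h⟩
        · rintro ⟨k, hk, rfl, h⟩
          rcases Nat.lt_succ_iff_lt_or_eq.1 hk with hk | rfl
          · exact ⟨k, hk, rfl, h⟩
          · exact absurd hin h
    · rw [holds_innerTest, hpt, hD'] at hin
      have h₃' : s₁.point 4 5 (s'.int 2 0) = s.point 0 1 n := h₃.trans hpt
      refine ⟨?_, fun z => ?_⟩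
      · rw [h₁, hc, Finset.range_add_one, Finset.filter_insert, if_pos hin,
          Finset.card_insert_of_notMem (by simp)]
      · constructor
        · rintro ⟨k, hk, rfl⟩
          rw [h₁] at hk
          rcases Nat.lt_succ_iff_lt_or_eq.1 hk with hk | rfl
          · obtain ⟨l, hl, h⟩ := (hp _).1 ⟨k, hk, rfl⟩
            rw [h₂ k hk]
            exact ⟨l, by omega, h⟩
          · rw [h₃']
            exact ⟨n, by omega, rfl, hin⟩
        · rintro ⟨k, hk, rfl, h⟩
          rw [h₁]
          rcases Nat.lt_succ_iff_lt_or_eq.1 hk with hk | rfl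
          · obtain ⟨l, hl, h'⟩ := (hp _).2 ⟨k, hk, rfl, h⟩
            exact ⟨l, by omega, (h₂ l hl).trans h'⟩
          · exact ⟨_, Nat.lt_succ_self _, h₃'⟩

/-! ### Testing all elements of a list -/

/-- Set the flag `f` to `1` if no value of the variable `4` below `l` satisfies `b`, and to `0`
otherwise. -/
def noneTest (f l : ℕ) (b : BExp) : Cmd :=
  .seq (.iset f (.lit 0) (.lit 1)) (.for 4 l (.ite b (.iset f (.lit 0) (.lit 0)) .skip))

theorem runs_noneTest {f l : ℕ} {b : BExp} {s : Store} {B : ℕ → Prop} (hl4 : l ≠ 4)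
    (hlf : l ≠ f) (hf4 : f ≠ 4)
    (hb : ∀ k < s.int l 0, ∀ s', Frame (noneTest f l b) s s' → s'.int 4 0 = k →
      (b.Holds s' ↔ B k)) :
    Runs (noneTest f l b) s ((s.int l 0 + 1) * (b.cost + 26)) fun s' =>
      0 < s'.int f 0 ↔ ∀ k < s.int l 0, ¬ B k := by
  refine Runs.mono (T := 3 + (s.int l 0 * ((b.cost + (3 + 1)) + 11) + 8)) ?_ (by nlinarith)
    fun _ _ h => h
  refine Runs.seq (Runs.iset ?_)
  refine Runs.for (Inv := fun n s' => 0 < s'.int f 0 ↔ ∀ k < n, ¬ B k) hl4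
    (by simp [hlf]) (by simp [Cmd.intVars, hlf]) (by simp [Cmd.intVars, hf4.symm])
    (fun n s' v h => by simpa [hf4] using h) (by simp) ?_
  intro n hn s' hfr hi hI
  have hfr' : Frame (noneTest f l b) s s' := by
    refine ⟨fun a ha => ?_, fun a ha => ?_⟩
    · rw [hfr.int a (by simp [noneTest, Cmd.for, Cmd.intVars] at ha ⊢; tauto)]
      have : a ≠ f := by rintro rfl; simp [noneTest, Cmd.intVars] at ha
      ext j
      simp [this]
    · rw [hfr.real a (by simp [Cmd.for, Cmd.realVars])]
      rfl
  have hB := hb n hn s' hfr' hi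
  refine Runs.ite (fun h => Runs.iset ?_) fun h => Runs.skip ?_
  · simp only [setInt_int, IExp.eval, and_self, if_true, lt_irrefl, false_iff]
    exact fun h' => h' n (by omega) (hB.1 h)
  · rw [hI]
    constructor
    · intro h' k hk
      rcases Nat.lt_succ_iff_lt_or_eq.1 hk with hk | rfl
      · exact h' k hk
      · exact fun hk' => h (hB.2 hk')
    · exact fun h' k hk => h' k (by omega)

/-! ### The half-plane test -/

/-- Vector of greatest slope, in the real variables `8` and `9`. -/
def maxSlopeBody (dx dy : RExp) : Cmd :=
  .ite (.and (.rlt (.lit 0) dx) (.rlt (.mul (.var 9) dx) (.mul (.var 8) dy)))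
    (.seq (.rset 8 (.lit 0) dx) (.rset 9 (.lit 0) dy)) .skip

def aboveTest (dx dy : RExp) : BExp := .rlt (.mul (.var 9) dx) (.mul (.var 8) dy)

/-- Set the flag `f` if the vectors `(dx, dy)`, computed for all values of the variable `4` below
the variable `2`, satisfy `UpperSupport`. -/
def halfPlaneTest (f : ℕ) (dx dy : RExp) : Cmd :=
  .seq (.rset 8 (.lit 0) (.lit 0)) (.seq (.rset 9 (.lit 0) (.lit (-1)))
    (.seq (.for 4 2 (maxSlopeBody dx dy)) (noneTest f 2 (aboveTest dx dy))))

/-- The hypotheses on `dx` and `dy` say that they depend only on the kept points, the outer index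
and the inner counter, none of which is spoiled by the scratch variables `8`, `9` or the flag; `5 ≤
f` keeps the flag off the counters and the length. -/
theorem runs_halfPlaneTest {f : ℕ} {dx dy : RExp} {dX dY : ℕ → ℝ} {s : Store} (hf : 5 ≤ f)
    (hdx : ∀ s', s'.real 4 = s.real 4 → s'.real 5 = s.real 5 → s'.int 3 = s.int 3 →
      dx.eval s' = dX (s'.int 4 0))
    (hdy : ∀ s', s'.real 4 = s.real 4 → s'.real 5 = s.real 5 → s'.int 3 = s.int 3 →
      dy.eval s' = dY (s'.int 4 0)) :
    Runs (halfPlaneTest f dx dy) s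
      ((s.int 2 0 + 1) * ((maxSlopeBody dx dy).bound + (aboveTest dx dy).cost + 50)) fun s' =>
      0 < s'.int f 0 ↔ UpperSupport dX dY (s.int 2 0) := by
  refine Runs.mono (T := 3 + (3 + ((s.int 2 0 * ((maxSlopeBody dx dy).bound + 11) + 8) +
    (s.int 2 0 + 1) * ((aboveTest dx dy).cost + 26)))) ?_ (by nlinarith) fun _ _ h => h
  refine Runs.seq (Runs.rset (Runs.seq (Runs.rset (Runs.seq ?_))))
  refine (Runs.for (Inv := fun n s' => MaxSlope dX dY n (s'.real 8 0) (s'.real 9 0))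
    (by decide) rfl (by simp [maxSlopeBody, Cmd.intVars]) (by simp [maxSlopeBody, Cmd.intVars])
    (fun n s' v h => h) ?_ ?_).mono le_rfl fun s₁ f₁ h₁ => ?_
  · simpa using MaxSlope.zero dX dY
  · intro n hn s' f' hi hI
    have h4 : s'.real 4 = s.real 4 := by
      rw [f'.real 4 (by simp [maxSlopeBody, Cmd.for, Cmd.realVars])]; ext; simp
    have h5 : s'.real 5 = s.real 5 := by
      rw [f'.real 5 (by simp [maxSlopeBody, Cmd.for, Cmd.realVars])]; ext; simp
    have h3 : s'.int 3 = s.int 3 := by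
      rw [f'.int 3 (by simp [maxSlopeBody, Cmd.for, Cmd.intVars])]; simp
    have ex := hdx s' h4 h5 h3
    have ey := hdy s' h4 h5 h3
    rw [hi] at ex ey
    refine Runs.ite (fun h => Runs.seq (Runs.rset (Runs.rset ?_))) fun h => Runs.skip ?_
    -- The second assignment evaluates `dy` in the store already changed by the first.
    · have ey' := hdy (s'.setReal 8 0 (dX n)) (by ext; simp [h4]) (by ext; simp [h5]) h3
      simp only [setReal_int, hi] at ey'
      simp [ex, ey] at h
      simpa [ex, ey'] using hI.update h.1 h.2
    · simp only [BExp.Holds, RExp.eval, IExp.eval, ex, ey, Int.cast_zero] at h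
      exact hI.keep h
  · have h4 : s₁.real 4 = s.real 4 := by
      rw [f₁.real 4 (by simp [maxSlopeBody, Cmd.for, Cmd.realVars])]; ext; simp
    have h5 : s₁.real 5 = s.real 5 := by
      rw [f₁.real 5 (by simp [maxSlopeBody, Cmd.for, Cmd.realVars])]; ext; simp
    have h3 : s₁.int 3 = s.int 3 := by
      rw [f₁.int 3 (by simp [maxSlopeBody, Cmd.for, Cmd.intVars])]; simp
    have h2 : s₁.int 2 = s.int 2 := by
      rw [f₁.int 2 (by simp [maxSlopeBody, Cmd.for, Cmd.intVars])]; simp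
    have key := runs_noneTest (f := f) (l := 2) (b := aboveTest dx dy) (s := s₁)
      (B := fun k => s₁.real 9 0 * dX k < s₁.real 8 0 * dY k) (by decide) (by omega) (by omega)
      fun k hk s' f' hi => by
        have g4 : s'.real 4 = s.real 4 := by
          rw [f'.real 4 (by simp [noneTest, Cmd.for, Cmd.realVars]), h4]
        have g5 : s'.real 5 = s.real 5 := by
          rw [f'.real 5 (by simp [noneTest, Cmd.for, Cmd.realVars]), h5]
        have g3 : s'.int 3 = s.int 3 := by
          rw [f'.int 3 (by simp [noneTest, Cmd.for, Cmd.intVars]; omega), h3]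
        have g8 : s'.real 8 = s₁.real 8 := f'.real 8 (by simp [noneTest, Cmd.for, Cmd.realVars])
        have g9 : s'.real 9 = s₁.real 9 := f'.real 9 (by simp [noneTest, Cmd.for, Cmd.realVars])
        simp [aboveTest, hdx s' g4 g5 g3, hdy s' g4 g5 g3, hi, g8, g9]
    rw [h2] at key
    refine key.mono le_rfl fun s₂ _ h₂ => ?_
    rw [h₂]
    exact h₁.upperSupport_iff.symm

end RealRAM

/-! ### Ranks -/

/-- The number of elements of the list `f 0, …, f (h - 1)` below `f k`. -/
noncomputable def rank {α : Type*} [LinearOrder α] (f : ℕ → α) (h k : ℕ) : ℕ :=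
  ((Finset.range h).filter fun l => f l < f k).card

section rank

variable {α : Type*} [LinearOrder α] {f : ℕ → α} {h : ℕ}

theorem rank_lt_rank {k l : ℕ} (hk : k < h) (hkl : f k < f l) : rank f h k < rank f h l := by
  refine Finset.card_lt_card ⟨fun i hi => ?_, fun hsub => ?_⟩
  · simp only [Finset.mem_filter] at hi ⊢
    exact ⟨hi.1, hi.2.trans hkl⟩
  · have := hsub (Finset.mem_filter.2 ⟨Finset.mem_range.2 hk, hkl⟩)
    simp at this

theorem rank_lt {k : ℕ} (hk : k < h) : rank f h k < h := by
  conv_rhs => rw [← Finset.card_range h]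
  refine Finset.card_lt_card ⟨Finset.filter_subset _ _, fun hsub => ?_⟩
  have := hsub (Finset.mem_range.2 hk)
  simp at this

theorem lt_of_rank_lt_rank {k l : ℕ} (hl : l < h) (hinj : ∀ k < h, ∀ l < h, f k = f l → k = l)
    (hk : k < h) (hkl : rank f h k < rank f h l) : f k < f l := by
  rcases lt_trichotomy (f k) (f l) with hlt | heq | hgt
  · exact hlt
  · rw [hinj k hk l hl heq] at hkl
    exact absurd hkl (lt_irrefl _)
  · exact absurd (rank_lt_rank hl hgt) hkl.not_gt

theorem rank_injOn (hinj : ∀ k < h, ∀ l < h, f k = f l → k = l) {k l : ℕ} (hk : k < h)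
    (hl : l < h) (hkl : rank f h k = rank f h l) : k = l := by
  rcases lt_trichotomy (f k) (f l) with hlt | heq | hgt
  · exact absurd hkl (rank_lt_rank hk hlt).ne
  · exact hinj k hk l hl heq
  · exact absurd hkl (rank_lt_rank hl hgt).ne'

/-- An injective map from `h` indices to `h` indices is onto. -/
theorem exists_rank_eq (hinj : ∀ k < h, ∀ l < h, f k = f l → k = l) {r : ℕ} (hr : r < h) :
    ∃ k < h, rank f h k = r := by
  have := Finset.surj_on_of_inj_on_of_card_le (s := Finset.range h) (t := Finset.range h)
    (fun k _ => rank f h k) (fun k hk => Finset.mem_range.2 (rank_lt (Finset.mem_range.1 hk)))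
    (fun k l hk hl hkl => rank_injOn hinj (Finset.mem_range.1 hk) (Finset.mem_range.1 hl) hkl)
    le_rfl r (Finset.mem_range.2 hr)
  obtain ⟨k, hk, rfl⟩ := this
  exact ⟨k, Finset.mem_range.1 hk, rfl⟩

end rank

namespace RealRAM

/-! ### Selecting the boundary points -/

/-- The list in the real arrays `4` and `5`, of length `int 2`, lies on one side of a line
through `z`. -/
def OnBoundary (X Y : ℕ → ℝ) (m : ℕ) (z : ℝ × ℝ) : Prop :=
  UpperSupport (fun k => X k - z.1) (fun k => Y k - z.2) m ∨
    UpperSupport (fun k => z.1 - X k) (fun k => z.2 - Y k) m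

/-- The entry of the real array `a` whose index is the value of the variable `i`. -/
abbrev RExp.at (a i : ℕ) : RExp := .get a (.var i)

/-- The `i`-th point in the arrays `4` and `5` equals the `j`-th one in `6` and `7`. -/
def samePoint : BExp :=
  .and (.and (.neg (.rlt (.at 6 4) (.at 4 3))) (.neg (.rlt (.at 4 3) (.at 6 4))))
    (.and (.neg (.rlt (.at 7 4) (.at 5 3))) (.neg (.rlt (.at 5 3) (.at 7 4))))

theorem holds_samePoint (s : Store) :
    samePoint.Holds s ↔ s.point 6 7 (s.int 4 0) = s.point 4 5 (s.int 3 0) := by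
  simp [samePoint, Store.point, le_antisymm_iff]
  tauto

def forwardTest : Cmd :=
  halfPlaneTest 5 (.sub (.at 4 4) (.at 4 3)) (.sub (.at 5 4) (.at 5 3))

def backwardTest : Cmd :=
  halfPlaneTest 6 (.sub (.at 4 3) (.at 4 4)) (.sub (.at 5 3) (.at 5 4))

/-- The disjunction of the forward and backward flags is expressed by the positivity of their sum.
-/
def selectTest : BExp := .and (.ilt (.lit 0) (.var 7)) (.ilt (.lit 0) (.add (.var 5) (.var 6)))

/-- Append the `i`-th point to the list of boundary points, if it is new and on the boundary. -/
def selectBody : Cmd :=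
  .seq forwardTest (.seq backwardTest (.seq (noneTest 7 1 samePoint)
    (.ite selectTest (append 6 7 1 (.at 4 3) (.at 5 3)) .skip)))

/-- Two half-plane tests over the kept points and a search for duplicates among the points already
selected. Since the latter are no more numerous, everything is linear in the kept count. -/
theorem exists_runs_selectBody : ∃ C, ∀ s : Store, s.int 1 0 ≤ s.int 2 0 →
    Runs selectBody s ((s.int 2 0 + 1) * C) fun s' =>
      (∀ k < s.int 1 0, s'.point 6 7 k = s.point 6 7 k) ∧
      (OnBoundary (s.real 4) (s.real 5) (s.int 2 0) (s.point 4 5 (s.int 3 0)) ∧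
          (∀ k < s.int 1 0, ¬ s.point 6 7 k = s.point 4 5 (s.int 3 0)) ∧
          s'.int 1 0 = s.int 1 0 + 1 ∧ s'.point 6 7 (s.int 1 0) = s.point 4 5 (s.int 3 0) ∨
        ¬ (OnBoundary (s.real 4) (s.real 5) (s.int 2 0) (s.point 4 5 (s.int 3 0)) ∧
          (∀ k < s.int 1 0, ¬ s.point 6 7 k = s.point 4 5 (s.int 3 0))) ∧
          s'.int 1 0 = s.int 1 0) := by
  obtain ⟨C₁, hC₁⟩ : ∃ C₁, ∀ s : Store, Runs forwardTest s ((s.int 2 0 + 1) * C₁) fun s' =>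
      0 < s'.int 5 0 ↔ UpperSupport (fun k => s.real 4 k - s.real 4 (s.int 3 0))
        (fun k => s.real 5 k - s.real 5 (s.int 3 0)) (s.int 2 0) := by
    refine ⟨_, fun s => runs_halfPlaneTest (by decide) ?_ ?_⟩ <;>
    · intro s' h4 h5 h3
      simp [h4, h5, h3]
  obtain ⟨C₂, hC₂⟩ : ∃ C₂, ∀ s : Store, Runs backwardTest s ((s.int 2 0 + 1) * C₂) fun s' =>
      0 < s'.int 6 0 ↔ UpperSupport (fun k => s.real 4 (s.int 3 0) - s.real 4 k)
        (fun k => s.real 5 (s.int 3 0) - s.real 5 k) (s.int 2 0) := by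
    refine ⟨_, fun s => runs_halfPlaneTest (by decide) ?_ ?_⟩ <;>
    · intro s' h4 h5 h3
      simp [h4, h5, h3]
  obtain ⟨C₃, hC₃⟩ : ∃ C₃, ∀ s : Store, Runs (noneTest 7 1 samePoint) s
      ((s.int 1 0 + 1) * C₃) fun s' =>
      0 < s'.int 7 0 ↔ ∀ k < s.int 1 0, ¬ s.point 6 7 k = s.point 4 5 (s.int 3 0) := by
    refine ⟨_, fun s => runs_noneTest (by decide) (by decide) (by decide) fun k hk s' f hi => ?_⟩
    rw [holds_samePoint, hi]
    have h3 := f.int 3 (by decide)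
    have h4 := f.real 4 (by decide)
    have h5 := f.real 5 (by decide)
    have h6 := f.real 6 (by decide)
    have h7 := f.real 7 (by decide)
    simp [Store.point, h3, h4, h5, h6, h7]
  refine ⟨C₁ + C₂ + C₃ + (selectTest.cost +
    ((append 6 7 1 (.at 4 3) (.at 5 3)).bound + 1)), fun s hs => ?_⟩
  refine Runs.mono (T := (s.int 2 0 + 1) * C₁ + ((s.int 2 0 + 1) * C₂ + ((s.int 1 0 + 1) * C₃ +
    (selectTest.cost + ((append 6 7 1 (.at 4 3) (.at 5 3)).bound + 1))))) ?_ ?_ fun _ _ h => h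
  · refine Runs.seq ((hC₁ s).mono le_rfl fun s₁ f₁ h₁ => ?_)
    have a1 := f₁.int 1 (by decide)
    have a2 := f₁.int 2 (by decide)
    have a3 := f₁.int 3 (by decide)
    have a4 := f₁.real 4 (by decide)
    have a5 := f₁.real 5 (by decide)
    have a6 := f₁.real 6 (by decide)
    have a7 := f₁.real 7 (by decide)
    have k₂ := hC₂ s₁
    rw [a2] at k₂
    refine Runs.seq (k₂.mono le_rfl fun s₂ f₂ h₂ => ?_)
    have b1 := (f₂.int 1 (by decide)).trans a1
    have b3 := (f₂.int 3 (by decide)).trans a3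
    have b4 := (f₂.real 4 (by decide)).trans a4
    have b5 := (f₂.real 5 (by decide)).trans a5
    have b6 := (f₂.real 6 (by decide)).trans a6
    have b7 := (f₂.real 7 (by decide)).trans a7
    have k₃ := hC₃ s₂
    rw [b1] at k₃
    refine Runs.seq (k₃.mono le_rfl fun s₃ f₃ h₃ => ?_)
    have c1 := (f₃.int 1 (by decide)).trans b1
    have c3 := (f₃.int 3 (by decide)).trans b3
    have c4 := (f₃.real 4 (by decide)).trans b4
    have c5 := (f₃.real 5 (by decide)).trans b5
    have c6 := (f₃.real 6 (by decide)).trans b6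
    have c7 := (f₃.real 7 (by decide)).trans b7
    have d5 : s₃.int 5 = s₁.int 5 := (f₃.int 5 (by decide)).trans (f₂.int 5 (by decide))
    have d6 : s₃.int 6 = s₂.int 6 := f₃.int 6 (by decide)
    rw [a3, a4, a5] at h₂
    simp only [Store.point, b3, b4, b5, b6, b7] at h₃
    have htest : selectTest.Holds s₃ ↔
        OnBoundary (s.real 4) (s.real 5) (s.int 2 0) (s.point 4 5 (s.int 3 0)) ∧
          (∀ k < s.int 1 0, ¬ s.point 6 7 k = s.point 4 5 (s.int 3 0)) := by
      simp only [OnBoundary, Store.point, ← h₁, ← h₂, ← h₃]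
      simp [selectTest, d5, d6]
      omega
    refine Runs.ite (fun ht => (runs_append (by decide) (by simp)).mono le_rfl
      fun s₄ _ ⟨e₁, e₂, e₃⟩ => ?_) fun ht => Runs.skip ?_
    · rw [c1] at e₁ e₂ e₃
      refine ⟨fun k hk => ?_, Or.inl ⟨(htest.1 ht).1, (htest.1 ht).2, e₁, ?_⟩⟩
      · rw [e₂ k hk]
        simp [Store.point, c6, c7]
      · rw [e₃]
        simp [Store.point, c3, c4, c5]
    · refine ⟨fun k _ => by simp [Store.point, c6, c7], Or.inr ⟨fun h => ht (htest.2 h), ?_⟩⟩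
      rw [c1]
  · have := Nat.mul_le_mul_right C₃ (Nat.succ_le_succ hs)
    simp only [Nat.succ_eq_add_one] at this
    nlinarith

/-- List the boundary points in the real arrays `6` and `7`. -/
def select : Cmd := .for 3 2 selectBody

theorem exists_runs_select : ∃ C, ∀ s : Store, s.int 1 0 = 0 →
    Runs select s ((s.int 2 0 + 1) ^ 2 * C) fun s' =>
      s'.int 1 0 ≤ s.int 2 0 ∧
      (∀ z, (∃ k < s'.int 1 0, s'.point 6 7 k = z) ↔
        ∃ k < s.int 2 0, s.point 4 5 k = z ∧ OnBoundary (s.real 4) (s.real 5) (s.int 2 0) z) ∧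
      ∀ k l, k < l → l < s'.int 1 0 → s'.point 6 7 k ≠ s'.point 6 7 l := by
  obtain ⟨C, hC⟩ := exists_runs_selectBody
  refine ⟨C + 11, fun s hs => ?_⟩
  refine Runs.mono (T := s.int 2 0 * ((s.int 2 0 + 1) * C + 11) + 8)
    (Runs.for (Inv := fun n s' => s'.int 1 0 ≤ n ∧
      (∀ z, (∃ k < s'.int 1 0, s'.point 6 7 k = z) ↔
        ∃ k < n, s.point 4 5 k = z ∧ OnBoundary (s.real 4) (s.real 5) (s.int 2 0) z) ∧
      ∀ k l, k < l → l < s'.int 1 0 → s'.point 6 7 k ≠ s'.point 6 7 l)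
      (by decide) rfl (by decide) (by decide) ?_ ?_ ?_) (by nlinarith) fun _ _ h => h
  · intro k s v h
    simpa [Store.point] using h
  · simp [hs]
  · intro n hn s' f hi ⟨hle, hpts, hinj⟩
    have a2 := f.int 2 (by decide)
    have a4 := f.real 4 (by decide)
    have a5 := f.real 5 (by decide)
    have key := hC s' (by rw [a2]; omega)
    have hpt : s'.point 4 5 (s'.int 3 0) = s.point 4 5 n := by simp [Store.point, a4, a5, hi]
    rw [a2, a4, a5, hpt] at key
    refine key.mono le_rfl fun s₁ _ ⟨hold, hnew⟩ => ?_
    rcases hnew with ⟨hb, hne, hlen, hlast⟩ | ⟨hn', hlen⟩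
    · rw [hlen]
      refine ⟨by omega, fun z => ?_, fun k l hkl hl => ?_⟩
      · constructor
        · rintro ⟨k, hk, rfl⟩
          rcases Nat.lt_succ_iff_lt_or_eq.1 hk with hk | rfl
          · obtain ⟨l, hl, h⟩ := (hpts _).1 ⟨k, hk, rfl⟩
            rw [hold k hk]
            exact ⟨l, by omega, h⟩
          · rw [hlast]
            exact ⟨n, by omega, rfl, hb⟩
        · rintro ⟨k, hk, rfl, h⟩
          rcases Nat.lt_succ_iff_lt_or_eq.1 hk with hk | rfl
          · obtain ⟨l, hl, h'⟩ := (hpts _).2 ⟨k, hk, rfl, h⟩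
            exact ⟨l, by omega, (hold l hl).trans h'⟩
          · exact ⟨_, Nat.lt_succ_self _, hlast⟩
      · rcases Nat.lt_succ_iff_lt_or_eq.1 hl with hl | rfl
        · rw [hold k (by omega), hold l hl]
          exact hinj k l hkl hl
        · rw [hold k hkl, hlast]
          exact hne k hkl
    · rw [hlen]
      refine ⟨by omega, fun z => ?_, fun k l hkl hl => ?_⟩
      · constructor
        · rintro ⟨k, hk, rfl⟩
          obtain ⟨l, hl, h⟩ := (hpts _).1 ⟨k, hk, rfl⟩
          rw [hold k hk]
          exact ⟨l, by omega, h⟩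
        · rintro ⟨k, hk, rfl, h⟩
          suffices H : ∃ l < s'.int 1 0, s'.point 6 7 l = s.point 4 5 k by
            obtain ⟨l, hl, h'⟩ := H
            exact ⟨l, hl, (hold l hl).trans h'⟩
          rcases Nat.lt_succ_iff_lt_or_eq.1 hk with hk | rfl
          · exact (hpts _).2 ⟨k, hk, rfl, h⟩
          -- A boundary point that was not appended must already be in the list.
          · by_contra! hcon
            exact hn' ⟨h, hcon⟩
      · rw [hold k (by omega), hold l hl]
        exact hinj k l hkl hl

/-! ### Sorting -/

/-- Point `j` comes before point `i` in the list in the arrays `6` and `7`. -/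
def lexTest : BExp :=
  .neg (.and (.neg (.rlt (.at 6 4) (.at 6 3)))
    (.neg (.and (.neg (.rlt (.at 6 3) (.at 6 4))) (.rlt (.at 7 4) (.at 7 3)))))

theorem holds_lexTest (s : Store) : lexTest.Holds s ↔
    toLex (s.point 6 7 (s.int 4 0)) < toLex (s.point 6 7 (s.int 3 0)) := by
  rw [Prod.Lex.toLex_lt_toLex]
  simp only [lexTest, BExp.Holds, RExp.eval, IExp.eval, Store.point]
  constructor
  · intro h
    by_contra! hcon
    refine h ⟨hcon.1.not_gt, fun h' => ?_⟩
    exact (hcon.2 (le_antisymm (not_lt.1 h'.1) hcon.1)).not_gt h'.2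
  · rintro (h | ⟨h, h'⟩) ⟨h₁, h₂⟩
    · exact h₁ h
    · exact h₂ ⟨by rw [h]; exact lt_irrefl _, h'⟩

def countBody : Cmd := .ite lexTest (.iset 8 (.lit 0) (.add (.var 8) (.lit 1))) .skip

/-- Store the `i`-th point at the index given by its rank. -/
def placeBody : Cmd :=
  .seq (.iset 8 (.lit 0) (.lit 0)) (.seq (.for 4 1 countBody)
    (.seq (.rset 2 (.var 8) (.at 6 3)) (.rset 3 (.var 8) (.at 7 3))))

/-- The rank of the `k`-th point. -/
noncomputable def Store.rank (s : Store) (h k : ℕ) : ℕ :=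
  _root_.rank (fun k => toLex (s.point 6 7 k)) h k

theorem runs_placeBody (s : Store) :
    Runs placeBody s ((s.int 1 0 + 1) * (countBody.bound + 40)) fun s' =>
      ∀ r, s'.point 2 3 r = if r = s.rank (s.int 1 0) (s.int 3 0) then s.point 6 7 (s.int 3 0)
        else s.point 2 3 r := by
  refine Runs.mono (T := 3 + ((s.int 1 0 * (countBody.bound + 11) + 8) + (6 + 6))) ?_
    (by nlinarith) fun _ _ h => h
  refine Runs.seq (Runs.iset (Runs.seq ?_))
  refine (Runs.for (Inv := fun n s' => s'.int 8 0 = s.rank n (s.int 3 0)) (by decide) (by simp)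
    (by decide) (by decide) (fun n s' v h => by simpa using h) ?_ ?_).mono le_rfl
    fun s₁ f₁ h₁ => ?_
  · simp [Store.rank, rank]
  · intro n hn s' f hi hI
    have hp : ∀ k, s'.point 6 7 k = s.point 6 7 k := fun k => by
      simp [Store.point, f.real 6 (by decide), f.real 7 (by decide)]
    have h3 : s'.int 3 0 = s.int 3 0 := by rw [f.int 3 (by decide)]; simp
    refine Runs.ite (fun h => Runs.iset ?_) fun h => Runs.skip ?_
    · rw [holds_lexTest, hp, hp, hi, h3] at h
      simp only [IExp.eval, setInt_int, and_self, if_true, hI]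
      simp only [Store.rank, rank]
      rw [Finset.range_add_one, Finset.filter_insert, if_pos h,
        Finset.card_insert_of_notMem (by simp)]
    · rw [holds_lexTest, hp, hp, hi, h3] at h
      rw [hI]
      simp only [Store.rank, rank]
      rw [Finset.range_add_one, Finset.filter_insert, if_neg h]
  · have hp : s₁.point 6 7 (s₁.int 3 0) = s.point 6 7 (s.int 3 0) := by
      simp [Store.point, f₁.real 6 (by decide), f₁.real 7 (by decide), f₁.int 3 (by decide)]
    have hq : ∀ k, s₁.point 2 3 k = s.point 2 3 k := fun k => by
      simp [Store.point, f₁.real 2 (by decide), f₁.real 3 (by decide)]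
    refine Runs.seq (Runs.rset (Runs.rset fun r => ?_))
    rw [← hp, ← hq, ← h₁]
    by_cases hr : r = s₁.int 8 0
    · simp [Store.point, hr]
    · simp [Store.point, hr]

/-- Sort the list in the real arrays `6` and `7` into the arrays `2` and `3`. -/
def place : Cmd := .for 3 1 placeBody

/-- Distinct points have distinct ranks, so no placed point is overwritten and the ranks fill an
initial segment; increasing rank is increasing lexicographic order. -/
theorem runs_place (s : Store)
    (hinj : ∀ k l, k < l → l < s.int 1 0 → s.point 6 7 k ≠ s.point 6 7 l) :
    Runs place s ((s.int 1 0 + 1) ^ 2 * (countBody.bound + 51)) fun s' =>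
      (∀ z, (∃ i < s.int 1 0, s'.point 2 3 i = z) ↔ ∃ i < s.int 1 0, s.point 6 7 i = z) ∧
      ∀ i j, i < j → j < s.int 1 0 → toLex (s'.point 2 3 i) < toLex (s'.point 2 3 j) := by
  have hinj' : ∀ k < s.int 1 0, ∀ l < s.int 1 0,
      toLex (s.point 6 7 k) = toLex (s.point 6 7 l) → k = l := by
    intro k hk l hl h
    have h' : s.point 6 7 k = s.point 6 7 l := toLex.injective h
    rcases lt_trichotomy k l with hlt | heq | hgt
    · exact absurd h' (hinj k l hlt hl)
    · exact heq
    · exact absurd h'.symm (hinj l k hgt hk)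
  refine Runs.mono (T := s.int 1 0 * ((s.int 1 0 + 1) * (countBody.bound + 40) + 11) + 8)
    (Runs.for (Inv := fun n s' => ∀ k < n, s'.point 2 3 (s.rank (s.int 1 0) k) = s.point 6 7 k)
      (by decide) rfl (by decide) (by decide) (fun _ _ _ h => h) (by simp) ?_) ?_
    fun s' _ h => ?_
  · intro n hn s' f hi hI
    have h1 : s'.int 1 = s.int 1 := f.int 1 (by decide)
    have hp : ∀ k, s'.point 6 7 k = s.point 6 7 k := fun k => by
      simp [Store.point, f.real 6 (by decide), f.real 7 (by decide)]
    have hr : ∀ h k, s'.rank h k = s.rank h k := fun h k => by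
      simp only [Store.rank, hp]
    have key := runs_placeBody s'
    simp only [h1, hi, hp, hr] at key
    refine key.mono le_rfl fun s₁ _ h k hk => ?_
    rw [h]
    split_ifs with hkn
    · rw [rank_injOn hinj' (by omega) hn hkn]
    · rcases Nat.lt_succ_iff_lt_or_eq.1 hk with hk | rfl
      · exact hI k hk
      · exact absurd rfl hkn
  · nlinarith
  · refine ⟨fun z => ⟨?_, ?_⟩, fun i j hij hj => ?_⟩
    · rintro ⟨i, hi, rfl⟩
      obtain ⟨k, hk, rfl⟩ := exists_rank_eq hinj' hi
      exact ⟨k, hk, (h k hk).symm⟩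
    · rintro ⟨k, hk, rfl⟩
      exact ⟨_, rank_lt hk, h k hk⟩
    · obtain ⟨k, hk, rfl⟩ := exists_rank_eq hinj' (hij.trans hj)
      obtain ⟨l, hl, rfl⟩ := exists_rank_eq hinj' hj
      have hkl := lt_of_rank_lt_rank hl hinj' hk hij
      have e₁ := h k hk
      have e₂ := h l hl
      simp only [Store.rank] at e₁ e₂
      rw [e₁, e₂]
      exact hkl

end RealRAM

/-! ### The algorithm -/

/-- The input point realising the distance of a corner is strictly closer to that corner than `z` in
both coordinates. -/
theorem RealRAM.IsInner.surrounded {X Y : ℕ → ℝ} {n : ℕ} (hn : 0 < n) {z : ℝ × ℝ}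
    (h : IsInner (cornerVal X Y n) z) : Surrounded {w | ∃ k < n, (X k, Y k) = w} z := by
  have key : ∀ b c, ∃ s ∈ {w | ∃ k < n, (X k, Y k) = w},
      unitFlip b s.1 < unitFlip b z.1 ∧ unitFlip c s.2 < unitFlip c z.2 := by
    intro b c
    obtain ⟨k, hk, h₁, h₂⟩ := exists_le_cornerDist (fun k => unitFlip b (X k))
      (fun k => unitFlip c (Y k)) hn
    exact ⟨_, ⟨k, hk, rfl⟩, h₁.trans_lt (h b c).1, h₂.trans_lt (h b c).2⟩
  have h₁ := key false false
  have h₂ := key true false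
  have h₃ := key false true
  have h₄ := key true true
  simp only [unitFlip, Bool.false_eq_true, if_false, if_true, sub_lt_sub_iff_left]
    at h₁ h₂ h₃ h₄
  exact ⟨h₁, h₂, h₃, h₄⟩

/-- Failing the test means that one coordinate, measured from some corner, is at most the distance
of that corner. The symmetry moves the corner to the origin and, by its third component, that
coordinate to the first place. -/
theorem exists_mem_nearAxis_of_not_inner {n : ℕ} {p : Fin n → ℝ × ℝ} {X Y : ℕ → ℝ}
    (hp : ∀ i : Fin n, p i = (X i, Y i)) {i : Fin n} (h : ¬ IsInner (cornerVal X Y n) (p i)) :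
    ∃ σ, i ∈ nearAxis (squareSymm σ) p := by
  have hle : ∀ b c (k : Fin n), cornerVal X Y n b c ≤
      max (unitFlip b (p k).1) (unitFlip c (p k).2) := fun b c k => by
    rw [hp k]
    exact cornerDist_le k.2
  simp only [IsInner, not_forall] at h
  obtain ⟨b, c, h⟩ := h
  rw [not_and_or, not_lt, not_lt] at h
  rcases h with h | h
  · refine ⟨(b, c, false), ?_⟩
    simp only [nearAxis, Finset.mem_filter, Finset.mem_univ, true_and, squareSymm,
      Bool.false_eq_true, if_false]
    exact fun k => h.trans (hle b c k)
  · refine ⟨(b, c, true), ?_⟩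
    simp only [nearAxis, Finset.mem_filter, Finset.mem_univ, true_and, squareSymm, if_true]
    exact fun k => h.trans ((hle b c k).trans_eq (max_comm _ _))

namespace RealRAM

/-- Bentley–Shamos type algorithm for the planar convex hull: throw away the points of an inner
rectangle and solve the problem for the remaining points in quadratic time. -/
def hullProgram : Cmd := .seq computeCorners (.seq throwAway (.seq select place))

open Classical in
/-- The number of points that are not thrown away. -/
noncomputable def keptCount {n : ℕ} (p : Fin n → ℝ × ℝ) : ℕ :=
  ((Finset.range n).filter fun k => ¬ IsInner
    (cornerVal ((hullInput p).real 0) ((hullInput p).real 1) n) ((hullInput p).point 0 1 k)).card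

theorem point_hullInput {n : ℕ} (p : Fin n → ℝ × ℝ) (i : Fin n) :
    (hullInput p).point 0 1 i = p i := by
  simp [Store.point, hullInput]

theorem keptCount_le {n : ℕ} (p : Fin n → ℝ × ℝ) :
    keptCount p ≤ ∑ σ, (nearAxis (squareSymm σ) p).card := by
  classical
  refine le_trans ?_ Finset.card_biUnion_le
  rw [← Finset.card_map Fin.valEmbedding, keptCount]
  refine Finset.card_le_card fun k hk => ?_
  rw [Finset.mem_filter, Finset.mem_range] at hk
  obtain ⟨hk, h⟩ := hk
  obtain ⟨σ, hσ⟩ := exists_mem_nearAxis_of_not_inner (i := ⟨k, hk⟩)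
    (fun i => (point_hullInput p i).symm) (by rwa [← point_hullInput p ⟨k, hk⟩])
  exact Finset.mem_map.2 ⟨⟨k, hk⟩, Finset.mem_biUnion.2 ⟨σ, Finset.mem_univ _, hσ⟩, rfl⟩

theorem exists_runs_hullProgram : ∃ C, ∀ (n : ℕ) (p : Fin n → ℝ × ℝ),
    Runs hullProgram (hullInput p) (C * (n + 1 + (keptCount p + 1) ^ 2))
      (IsHullOutput (range p)) := by
  obtain ⟨C, hC⟩ := exists_runs_select
  refine ⟨(initCorners.bound + cornerSteps.bound + 11) + (throwAwayBody.bound + 11) + C +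
    (countBody.bound + 51), fun n p => ?_⟩
  set s := hullInput p with hs
  have hn : s.int 0 0 = n := by simp [hs, hullInput]
  have k₁ := runs_computeCorners s
  rw [hn] at k₁
  refine Runs.mono (T := (n + 1) * (initCorners.bound + cornerSteps.bound + 11) +
    ((n + 1) * (throwAwayBody.bound + 11) + ((keptCount p + 1) ^ 2 * C +
      (keptCount p + 1) ^ 2 * (countBody.bound + 51)))) ?_ ?_ fun _ _ h => h
  · refine Runs.seq (k₁.mono le_rfl fun s₁ f₁ h₁ => ?_)
    have a1 : s₁.int 1 = s.int 1 := f₁.int 1 (by decide)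
    have hn₁ : s₁.int 0 0 = n := by rw [f₁.int 0 (by decide), hn]
    have hp₁ : s₁.point 0 1 = s.point 0 1 := by
      ext k : 1
      simp [Store.point, f₁.real 0 (by decide), f₁.real 1 (by decide)]
    have k₂ := runs_throwAway s₁ (by rw [f₁.int 2 (by decide)]; simp [hs, hullInput]) h₁
    rw [hn₁, hp₁] at k₂
    refine Runs.seq (k₂.mono le_rfl fun s₂ f₂ ⟨hm, hK⟩ => ?_)
    have b1 : s₂.int 1 0 = 0 := by
      rw [f₂.int 1 (by decide), a1]
      simp [hs, hullInput]
    replace hm : s₂.int 2 0 = keptCount p := hm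
    have k₃ := hC s₂ b1
    rw [hm] at k₃ hK
    refine Runs.seq (k₃.mono le_rfl fun s₃ f₃ ⟨hle, hH, hinj⟩ => ?_)
    have hcost : (s₃.int 1 0 + 1) ^ 2 * (countBody.bound + 51) ≤
        (keptCount p + 1) ^ 2 * (countBody.bound + 51) :=
      Nat.mul_le_mul_right _ (Nat.pow_le_pow_left (Nat.succ_le_succ hle) 2)
    refine (runs_place s₃ hinj).mono hcost fun s₄ f₄ ⟨hout, hsort⟩ => ?_
    have hlen : outLength s₄ = s₃.int 1 0 := by rw [outLength, f₄.int 1 (by decide)]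
    refine ⟨?_, fun i j hij hj => ?_⟩
    · set S : Set (ℝ × ℝ) := range p
      set K : Set (ℝ × ℝ) := {z | ∃ k < keptCount p, (s₂.real 4 k, s₂.real 5 k) = z}
      have hSfin : S.Finite := finite_range p
      have hS : S = {z | ∃ k < n, (s.real 0 k, s.real 1 k) = z} := by
        ext z
        constructor
        · rintro ⟨i, rfl⟩
          exact ⟨i, i.2, point_hullInput p i⟩
        · rintro ⟨k, hk, rfl⟩
          exact ⟨⟨k, hk⟩, (point_hullInput p ⟨k, hk⟩).symm⟩
      have hsur : ∀ z, z ∈ S → IsInner (cornerVal (s.real 0) (s.real 1) n) z →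
          Surrounded S z := by
        rintro z hz hin
        obtain ⟨i, -⟩ := hz
        rw [hS]
        -- Positivity of `n` comes from the existence of an input point.
        exact hin.surrounded (Nat.zero_lt_of_lt i.2)
      have hKmem : ∀ z, z ∈ K ↔ z ∈ S ∧ ¬ IsInner (cornerVal (s.real 0) (s.real 1) n) z := by
        intro z
        refine (hK z).trans ?_
        rw [hS]
        constructor
        · rintro ⟨k, hk, rfl, h⟩
          exact ⟨⟨k, hk, rfl⟩, h⟩
        · rintro ⟨⟨k, hk, rfl⟩, h⟩
          exact ⟨k, hk, rfl, h⟩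
      have hKS : ∀ z ∈ S, z ∈ K ∨ Surrounded S z := fun z hz => by
        by_cases hin : IsInner (cornerVal (s.real 0) (s.real 1) n) z
        · exact Or.inr (hsur z hz hin)
        · exact Or.inl ((hKmem z).2 ⟨hz, hin⟩)
      -- Testing against the kept points alone is therefore as good as testing against the whole
      -- input.
      have hsup : ∀ z, (∃ a b, (a ≠ 0 ∨ b ≠ 0) ∧ Supports a b S z) ↔
          ∃ a b, (a ≠ 0 ∨ b ≠ 0) ∧ Supports a b K z := by
        intro z
        constructor
        · rintro ⟨a, b, hab, h⟩
          exact ⟨a, b, hab, fun w hw => h w ((hKmem w).1 hw).1⟩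
        · rintro ⟨a, b, hab, h⟩
          exact ⟨a, b, hab, supports_of_subset hSfin hKS hab h⟩
      ext z
      rw [hlen]
      refine (hout z).trans ((hH z).trans ?_)
      have hbd : OnBoundary (s₂.real 4) (s₂.real 5) (keptCount p) z ↔
          ∃ a b, (a ≠ 0 ∨ b ≠ 0) ∧ Supports a b S z := by
        rw [hsup]
        exact exists_supports_iff.symm
      rw [mem_inter_iff]
      constructor
      · rintro ⟨k, hk, rfl, h⟩
        have hz : s₂.point 4 5 k ∈ S := ((hKmem _).1 ⟨k, hk, rfl⟩).1
        exact ⟨hz, (mem_frontier_convexHull_iff hSfin hz).2 (hbd.1 h)⟩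
      · rintro ⟨hz, hfr⟩
        rcases hKS z hz with ⟨k, hk, rfl⟩ | hsu
        · exact ⟨k, hk, rfl, hbd.2 ((mem_frontier_convexHull_iff hSfin hz).1 hfr)⟩
        · exact absurd hfr (hsu.notMem_frontier hSfin hz)
    · rw [hlen] at hj
      exact Prod.Lex.toLex_lt_toLex.1 (hsort i j hij hj)
  · ring_nf
    nlinarith [Nat.zero_le n, Nat.zero_le (keptCount p)]

theorem exists_lintegral_runTime_hullProgram_le : ∃ C : ℝ≥0, ∀ n : ℕ, 1 ≤ n →
    ∫⁻ p, runTime hullProgram (hullInput p) ∂(uniformPoints n) ≤ (C : ℝ≥0∞) * (n : ℝ≥0∞) := by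
  obtain ⟨C, hC⟩ := exists_runs_hullProgram
  -- `(n + 3) + 2 * 128 * n ≤ 260 * n` for `n ≥ 1`.
  refine ⟨(C * 260 : ℕ), fun n hn => ?_⟩
  have hle : ∀ p : Fin n → ℝ × ℝ, runTime hullProgram (hullInput p) ≤
      (C * (n + 3) : ℕ) + (C * 2 : ℕ) * (keptCount p : ℝ≥0∞) ^ 2 := by
    intro p
    obtain ⟨t, ht, s', he, -⟩ := hC n p
    refine (runTime_le he).trans ?_
    have : t ≤ C * (n + 3) + C * 2 * keptCount p ^ 2 := by
      refine ht.trans ?_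
      -- From `(k + 1) ^ 2 ≤ 2 * k ^ 2 + 2`, so that only the second moment is needed.
      have : n + 1 + (keptCount p + 1) ^ 2 ≤ (n + 3) + 2 * keptCount p ^ 2 := by
        zify
        nlinarith [sq_nonneg ((keptCount p : ℤ) - 1)]
      calc C * (n + 1 + (keptCount p + 1) ^ 2) ≤ C * ((n + 3) + 2 * keptCount p ^ 2) :=
            Nat.mul_le_mul_left C this
        _ = _ := by ring
    exact_mod_cast this
  calc ∫⁻ p, runTime hullProgram (hullInput p) ∂(uniformPoints n)
      ≤ ∫⁻ p, ((C * (n + 3) : ℕ) + (C * 2 : ℕ) * (keptCount p : ℝ≥0∞) ^ 2)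
          ∂(uniformPoints n) := lintegral_mono hle
    _ = (C * (n + 3) : ℕ) + (C * 2 : ℕ) * ∫⁻ p, (keptCount p : ℝ≥0∞) ^ 2 ∂(uniformPoints n) := by
        rw [lintegral_add_left measurable_const, lintegral_const_mul' _ _ (ENNReal.natCast_ne_top _)]
        simp
    _ ≤ (C * (n + 3) : ℕ) + (C * 2 : ℕ) * (128 * n) := by
        gcongr
        exact lintegral_sq_le_of_le_sum_nearAxis keptCount_le
    _ ≤ ((C * 260 : ℕ) : ℝ≥0) * (n : ℝ≥0∞) := by
        have : C * (n + 3) + C * 2 * (128 * n) ≤ C * 260 * n := by nlinarith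
        exact_mod_cast this

end RealRAM

theorem theoremt :
    ∃ c : Cmd, SolvesConvexHull c ∧
      (∀ n : ℕ, Measurable fun p : Fin n → ℝ × ℝ => runTime c (hullInput p)) ∧
      ∃ C : ℝ≥0, ∀ n : ℕ, 1 ≤ n →
        ∫⁻ p, runTime c (hullInput p) ∂(uniformPoints n) ≤ (C : ℝ≥0∞) * (n : ℝ≥0∞) := by
  refine ⟨hullProgram, fun n p => ?_, fun n => (measurable_runTime _).comp (measurable_hullInput n),
    exists_lintegral_runTime_hullProgram_le⟩
  obtain ⟨C, hC⟩ := exists_runs_hullProgram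
  obtain ⟨t, -, s, he, hs⟩ := hC n p
  exact ⟨t, s, he, hs⟩
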